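/- Let $n\ge 1$, let $B_n$ be the open unit ball of $\mathbb C^n$ and $\sigma$ the normalized rotation invariant measure on $\partial B_n$. For $1\le p<\infty$ let $H^p$ be the space of holomorphic functions $f$ on $B_n$ with $\|f\|_p=\sup_{0<r<1}\left(\int_{\partial B_n}|f(r\xi)|^p\,d\sigma(\xi)\right)^{1/p}<\infty$, and let $H^\infty$ be the space of bounded holomorphic functions on $B_n$ with the supremum norm. Let $\varphi:B_n\to B_n$ and $\psi:B_n\to\mathbb C$ be holomorphic and put $W_{\psi,\varphi}f=\psi\cdot(f\circ\varphi)$. Theorem 5.2 and Corollary 5.1. Let $1<p<\infty$ and suppose that $W_{\psi,\varphi}$ is a bounded operator from $H^p$ to $H^\infty$. Then the limit $$L=\lim_{\delta\to0^+}\ \sup\left\{\frac{|\psi(z)|}{(1-|\varphi(z)|^2)^{n/p}} : z\in B_n,\ \operatorname{dist}(\varphi(z),\partial B_n)<\delta\right\}$$ exists and is finite (the supremum of the empty set being $0$), and the essential norm $\|W_{\psi,\varphi}\|_e=\inf\{\|W_{\psi,\varphi}-K\| : K:H^p\to H^\infty \text{ compact linear}\}$ satisfies $$L\le\|W_{\psi,\varphi}\|_e\le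 2L.$$ Moreover, $W_{\psi,\varphi}:H^p\to H^\infty$ is compact if and only if $L=0$. -/

import Mathlib

open Set Filter Topology MeasureTheory Metric
open scoped ENNReal NNReal

noncomputable section

/-- `ℂⁿ` with its Euclidean norm; the open unit ball `Bₙ` is `ball (0 : Cn n) 1` and its boundary
is `sphere (0 : Cn n) 1`. -/
abbrev Cn (n : ℕ) : Type := EuclideanSpace ℂ (Fin n)

/-- The normalized rotation invariant measure `σ` on the unit sphere of `ℂⁿ`: the surface measure
induced by Lebesgue measure, divided by its total mass. -/
def sphereMeasure (n : ℕ) : Measure (sphere (0 : Cn n) 1) :=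
  ((volume : Measure (Cn n)).toSphere univ)⁻¹ • (volume : Measure (Cn n)).toSphere

/-- The extended Hardy norm, for an exponent `p ∈ (0, ∞]`. For `p < ∞` it is
`sup_{0 < r < 1} (∫ |f(rξ)|^p dσ(ξ))^{1/p}`; for `p = ∞` it is the supremum of `|f|` over the ball. -/
def hardyENorm (n : ℕ) (p : ℝ≥0∞) (f : Cn n → ℂ) : ℝ≥0∞ :=
  if p = ∞ then ⨆ z ∈ ball (0 : Cn n) 1, ‖f z‖ₑ
  else ⨆ r ∈ Ioo (0 : ℝ) 1,
    eLpNorm (fun ξ : sphere (0 : Cn n) 1 => f (r • (ξ : Cn n))) p (sphereMeasure n)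

/-- Holomorphic functions on the unit ball of `ℂⁿ`. A function on the ball is represented by its
extension by zero to `ℂⁿ`, so that equality of elements is equality on the ball. -/
def holomorphicBall (n : ℕ) : Submodule ℂ (Cn n → ℂ) where
  carrier := {f | DifferentiableOn ℂ f (ball 0 1) ∧ ∀ z ∉ ball (0 : Cn n) 1, f z = 0}
  add_mem' := by
    rintro f g ⟨hf, hf'⟩ ⟨hg, hg'⟩
    exact ⟨hf.add hg, fun z hz => by simp [hf' z hz, hg' z hz]⟩
  zero_mem' := ⟨differentiableOn_const _, fun _ _ => rfl⟩
  smul_mem' := by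
    rintro c f ⟨hf, hf'⟩
    exact ⟨hf.const_smul c, fun z hz => by simp [hf' z hz]⟩

section HardyENorm

variable {n : ℕ} {p : ℝ≥0∞} {f g : Cn n → ℂ}

theorem continuous_dilate (hf : f ∈ holomorphicBall n) {r : ℝ} (hr : r ∈ Ioo (0 : ℝ) 1) :
    Continuous (fun ξ : sphere (0 : Cn n) 1 => f (r • (ξ : Cn n))) := by
  refine hf.1.continuousOn.comp_continuous (by fun_prop) fun ξ => ?_
  have h1 : ‖(ξ : Cn n)‖ = 1 := by simp
  rw [mem_ball_zero_iff, norm_smul, h1, mul_one, Real.norm_eq_abs, abs_of_pos hr.1]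
  exact hr.2

theorem hardyENorm_zero : hardyENorm n p 0 = 0 := by
  unfold hardyENorm
  split_ifs with h
  · simp
  · simp only [Pi.zero_apply]
    simp

theorem hardyENorm_smul (c : ℂ) : hardyENorm n p (c • f) = ‖c‖ₑ * hardyENorm n p f := by
  unfold hardyENorm
  split_ifs with h
  · simp only [ENNReal.mul_iSup, Pi.smul_apply, enorm_smul]
  · simp only [ENNReal.mul_iSup]
    refine iSup_congr fun r => iSup_congr fun hr => ?_
    exact eLpNorm_const_smul c (fun ξ : sphere (0 : Cn n) 1 => f (r • (ξ : Cn n))) p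
      (sphereMeasure n)

theorem hardyENorm_add_le (hp : 1 ≤ p) (hf : f ∈ holomorphicBall n)
    (hg : g ∈ holomorphicBall n) :
    hardyENorm n p (f + g) ≤ hardyENorm n p f + hardyENorm n p g := by
  unfold hardyENorm
  split_ifs with h
  · refine iSup₂_le fun z hz => (enorm_add_le (f z) (g z)).trans ?_
    exact add_le_add (le_iSup₂ (f := fun z (_ : z ∈ ball (0 : Cn n) 1) => ‖f z‖ₑ) z hz)
      (le_iSup₂ (f := fun z (_ : z ∈ ball (0 : Cn n) 1) => ‖g z‖ₑ) z hz)
  · refine iSup₂_le fun r hr => ?_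
    refine (eLpNorm_add_le (continuous_dilate hf hr).aestronglyMeasurable
      (continuous_dilate hg hr).aestronglyMeasurable hp).trans ?_
    exact add_le_add
      (le_iSup₂ (f := fun r (_ : r ∈ Ioo (0 : ℝ) 1) =>
        eLpNorm (fun ξ : sphere (0 : Cn n) 1 => f (r • (ξ : Cn n))) p (sphereMeasure n)) r hr)
      (le_iSup₂ (f := fun r (_ : r ∈ Ioo (0 : ℝ) 1) =>
        eLpNorm (fun ξ : sphere (0 : Cn n) 1 => g (r • (ξ : Cn n))) p (sphereMeasure n)) r hr)

instance : (sphereMeasure n).IsOpenPosMeasure := by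
  exact Measure.isOpenPosMeasure_smul _ (ENNReal.inv_ne_zero.2 (measure_ne_top _ _))

theorem eq_zero_of_hardyENorm_eq_zero [NeZero n] (hp : 1 ≤ p) (hf : f ∈ holomorphicBall n)
    (h0 : hardyENorm n p f = 0) : f = 0 := by
  have key : ∀ z ∈ ball (0 : Cn n) 1, z ≠ 0 → f z = 0 := by
    intro z hz hz0
    unfold hardyENorm at h0
    split_ifs at h0 with h
    · simp only [ENNReal.iSup_eq_zero] at h0
      exact enorm_eq_zero.1 (h0 z hz)
    · simp only [ENNReal.iSup_eq_zero] at h0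
      have hpos : 0 < ‖z‖ := norm_pos_iff.2 hz0
      have hr : ‖z‖ ∈ Ioo (0 : ℝ) 1 := ⟨hpos, mem_ball_zero_iff.1 hz⟩
      have hc := continuous_dilate hf hr
      have hae := (eLpNorm_eq_zero_iff hc.aestronglyMeasurable
        (zero_lt_one.trans_le hp).ne').1 (h0 _ hr)
      have heq := (hc.ae_eq_iff_eq (sphereMeasure n) continuous_zero).1 hae
      have hmem : ‖z‖⁻¹ • z ∈ sphere (0 : Cn n) 1 := by
        rw [mem_sphere_zero_iff_norm, norm_smul, norm_inv, norm_norm, inv_mul_cancel₀ hpos.ne']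
      have h1 := congrFun heq ⟨_, hmem⟩
      simpa [smul_smul, mul_inv_cancel₀ hpos.ne'] using h1
  funext z
  by_cases hz : z ∈ ball (0 : Cn n) 1
  · by_cases hz0 : z = 0
    · subst hz0
      have hct : ContinuousAt f 0 :=
        hf.1.continuousOn.continuousAt (isOpen_ball.mem_nhds hz)
      have h1 : Tendsto f (𝓝[≠] 0) (𝓝 (f 0)) := hct.tendsto.mono_left nhdsWithin_le_nhds
      have h2 : f =ᶠ[𝓝[≠] 0] fun _ => 0 := by
        filter_upwards [self_mem_nhdsWithin, nhdsWithin_le_nhds (isOpen_ball.mem_nhds hz)]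
          with w hw hw'
        exact key w hw' hw
      have : (𝓝[≠] (0 : Cn n)).NeBot := Module.punctured_nhds_neBot ℂ (Cn n) 0
      exact tendsto_nhds_unique h1 (tendsto_const_nhds.congr' h2.symm)
    · exact key z hz hz0
  · exact hf.2 z hz

end HardyENorm

/-- The Hardy space `H^p(Bₙ)`, `1 ≤ p ≤ ∞`, as a linear space: the holomorphic functions on the
ball with finite Hardy norm. -/
def hardySubmodule (n : ℕ) (p : ℝ≥0∞) [hp : Fact (1 ≤ p)] : Submodule ℂ (Cn n → ℂ) where
  carrier := {f | f ∈ holomorphicBall n ∧ hardyENorm n p f < ∞}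
  add_mem' := by
    rintro f g ⟨hf, hf'⟩ ⟨hg, hg'⟩
    exact ⟨add_mem hf hg,
      (hardyENorm_add_le hp.out hf hg).trans_lt (ENNReal.add_lt_top.2 ⟨hf', hg'⟩)⟩
  zero_mem' := ⟨zero_mem _, by simp [hardyENorm_zero]⟩
  smul_mem' := by
    rintro c f ⟨hf, hf'⟩
    exact ⟨Submodule.smul_mem _ c hf, by
      rw [hardyENorm_smul]; exact ENNReal.mul_lt_top enorm_lt_top hf'⟩

/-- The type of elements of `H^p(Bₙ)`; it carries the topology of the Hardy norm (and not that of
pointwise convergence). -/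
def HardySpace (n : ℕ) (p : ℝ≥0∞) [Fact (1 ≤ p)] : Type := hardySubmodule n p

namespace HardySpace

variable {n : ℕ} {p : ℝ≥0∞} [Fact (1 ≤ p)]

instance : AddCommGroup (HardySpace n p) := inferInstanceAs (AddCommGroup (hardySubmodule n p))

instance : Module ℂ (HardySpace n p) := inferInstanceAs (Module ℂ (hardySubmodule n p))

/-- The function underlying an element of `H^p(Bₙ)`. -/
def toFun (f : HardySpace n p) : Cn n → ℂ := Subtype.val f

instance : CoeFun (HardySpace n p) (fun _ => Cn n → ℂ) := ⟨toFun⟩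

instance : Norm (HardySpace n p) := ⟨fun f => (hardyENorm n p f).toReal⟩

theorem normCore [NeZero n] : NormedSpace.Core ℂ (HardySpace n p) where
  norm_nonneg f := ENNReal.toReal_nonneg
  norm_smul c f := by
    change (hardyENorm n p (c • f.toFun)).toReal = _ * (hardyENorm n p f).toReal
    rw [hardyENorm_smul, ENNReal.toReal_mul, toReal_enorm]
  norm_triangle f g := by
    change (hardyENorm n p (f.toFun + g.toFun)).toReal ≤
      (hardyENorm n p f).toReal + (hardyENorm n p g).toReal
    have hf : hardyENorm n p f.toFun ≠ ∞ := f.2.2.ne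
    have hg : hardyENorm n p g.toFun ≠ ∞ := g.2.2.ne
    rw [← ENNReal.toReal_add hf hg]
    exact ENNReal.toReal_mono (ENNReal.add_ne_top.2 ⟨hf, hg⟩)
      (hardyENorm_add_le Fact.out f.2.1 g.2.1)
  norm_eq_zero_iff f := by
    constructor
    · intro h
      have h' : hardyENorm n p f = 0 :=
        ((ENNReal.toReal_eq_zero_iff _).1 h).resolve_right f.2.2.ne
      exact Subtype.ext (eq_zero_of_hardyENorm_eq_zero Fact.out f.2.1 h')
    · rintro rfl
      change (hardyENorm n p 0).toReal = 0
      rw [hardyENorm_zero, ENNReal.toReal_zero]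

instance [NeZero n] : NormedAddCommGroup (HardySpace n p) := NormedAddCommGroup.ofCore normCore

instance [NeZero n] : NormedSpace ℂ (HardySpace n p) := NormedSpace.ofCore normCore

end HardySpace

/-- The weighted composition `W_{ψ,φ} f = ψ · (f ∘ φ)` on the unit ball (extended by zero). -/
def weightedComp {n : ℕ} (ψ : Cn n → ℂ) (φ : Cn n → Cn n) (f : Cn n → ℂ) : Cn n → ℂ :=
  (ball (0 : Cn n) 1).indicator fun z => ψ z * f (φ z)

/-- The essential norm of a bounded operator: its distance to the compact operators. -/
def essentialNorm {E F : Type*} [NormedAddCommGroup E] [NormedSpace ℂ E] [NormedAddCommGroup F]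
    [NormedSpace ℂ F] (T : E →L[ℂ] F) : ℝ :=
  ⨅ K : {K : E →L[ℂ] F // IsCompactOperator K}, ‖T - K.1‖

/-- The supremum of `|ψ(z)| / (1 - |φ(z)|²)^{n/p}` over those `z` in the ball for which
`dist(φ(z), ∂Bₙ) < δ`, with values in `[0, ∞]`; it is `0` if there is no such `z`. -/
def boundarySup {n : ℕ} (p : ℝ≥0∞) (ψ : Cn n → ℂ) (φ : Cn n → Cn n) (δ : ℝ) : ℝ≥0∞ :=
  ⨆ z ∈ {z : Cn n | z ∈ ball (0 : Cn n) 1 ∧ infDist (φ z) (sphere (0 : Cn n) 1) < δ},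
    ENNReal.ofReal (‖ψ z‖ / (1 - ‖φ z‖ ^ 2) ^ ((n : ℝ) / p.toReal))

end

noncomputable section

/-! ### The invariant measure on the sphere -/

/-! Everything rests on the normalized kernels `k_w(z) = (1 - |w|²)^{n/p} (1 - ⟨z, w⟩)^{-2n/p}`.
They have norm at most one in `H^p`, and `|k_w(w)| = (1 - |w|²)^{-n/p}` is exactly the sharp growth
bound `|f(w)| ≤ (1 - |w|²)^{-n/p} ‖f‖`. Both facts come from the Cauchy–Szegő formula
`integral_sphere_mul_szego`, applied on spheres of radius below one so that no boundary values are
needed. Since the weight quotient at `z` is `|(W k_{φ(z)})(z)|`, it is bounded by `‖W‖`. The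
boundary suprema decrease with `δ`, so their limit `L` exists and is finite.

Lower bound: if `|φ(z_j)| → 1`, a compact `K` sends a subsequence of the kernels at `φ(z_j)` to
zero, so `‖W - K‖` is at least the limiting weight quotients. The null property
(`tendsto_map_kernel_zero`) is proved without duality. Kernels approaching a boundary point
concentrate there, so a suitable sum `F` of `N` of them satisfies `‖F‖^p ≤ 2N`. If their images
tended to `g ≠ 0`, then `K F` would have norm at least `N‖g‖/2`, which contradicts `‖K F‖ ≤ ‖K‖
(2N)^{1/p}` for large `N` because `p > 1`.

Upper bound: compare `W` with `W ∘ D_r`, where `D_r f = f(r ·)`. This operator is compact because it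
only sees `f` on a smaller closed ball, where Arzelà–Ascoli applies. Where `φ(z)` is near the
boundary, the growth bound for `f - D_r f`, of norm at most `2‖f‖`, gives the factor 2. Elsewhere a
Lipschitz estimate makes the difference small as `r → 1`. When `L = 0` this exhibits `W` as a norm
limit of compact operators. -/

theorem finrank_real_Cn (n : ℕ) : Module.finrank ℝ (Cn n) = 2 * n := by
  have h := Module.finrank_mul_finrank ℝ ℂ (Cn n)
  rw [Complex.finrank_real_complex] at h
  rw [← h]; simp

instance isProbabilityMeasure_sphereMeasure (n : ℕ) [NeZero n] :
    IsProbabilityMeasure (sphereMeasure n) := by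
  refine ⟨?_⟩
  rw [sphereMeasure, Measure.smul_apply, smul_eq_mul]
  exact ENNReal.inv_mul_cancel ((Measure.measure_univ_ne_zero).2 (Measure.toSphere_ne_zero _))
    (measure_ne_top _ _)

/-- The homeomorphism of the unit sphere induced by a unitary map. -/
def sphereHomeo {n : ℕ} (U : Cn n ≃ₗᵢ[ℂ] Cn n) : sphere (0 : Cn n) 1 ≃ₜ sphere (0 : Cn n) 1 where
  toFun ξ := ⟨U ξ, by simp⟩
  invFun ξ := ⟨U.symm ξ, by simp⟩
  left_inv ξ := by simp
  right_inv ξ := by simp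
  continuous_toFun := by fun_prop
  continuous_invFun := by fun_prop

-- The surface measure of a set is a multiple of the volume of the cone over it. The cone over a
-- preimage under `U` is the preimage of the cone, and `U` preserves volume.
open scoped Pointwise in
theorem measurePreserving_sphereHomeo {n : ℕ} (U : Cn n ≃ₗᵢ[ℂ] Cn n) :
    MeasurePreserving (sphereHomeo U) (sphereMeasure n) (sphereMeasure n) := by
  have key : MeasurePreserving (sphereHomeo U) ((volume : Measure (Cn n)).toSphere)
      ((volume : Measure (Cn n)).toSphere) := by
    refine ⟨(sphereHomeo U).continuous.measurable, ?_⟩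
    ext s hs
    rw [Measure.map_apply (sphereHomeo U).continuous.measurable hs, Measure.toSphere_apply' _ hs,
      Measure.toSphere_apply' _ ((sphereHomeo U).continuous.measurable hs)]
    congr 1
    have hV : MeasurePreserving U (volume : Measure (Cn n)) volume :=
      LinearIsometryEquiv.measurePreserving
        ({ U.toLinearEquiv.restrictScalars ℝ with norm_map' := U.norm_map } : Cn n ≃ₗᵢ[ℝ] Cn n)
    have hemb : MeasurableEmbedding U := U.toHomeomorph.measurableEmbedding
    rw [← hV.measure_preimage_emb hemb (Ioo (0 : ℝ) 1 • (Subtype.val '' s))]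
    congr 1
    ext x
    simp only [Set.mem_smul, mem_preimage]
    constructor
    · rintro ⟨r, hr, y, ⟨ξ, hξ, rfl⟩, rfl⟩
      refine ⟨r, hr, U ξ, ⟨_, hξ, rfl⟩, ?_⟩
      change r • U ξ = U (r • (ξ : Cn n))
      rw [← Complex.coe_smul, ← Complex.coe_smul, map_smul]
    · rintro ⟨r, hr, y, ⟨ξ, hξ, rfl⟩, h⟩
      refine ⟨r, hr, U.symm ξ, ⟨(sphereHomeo U).symm ξ, by simpa using hξ, rfl⟩, ?_⟩
      apply U.injective
      rw [← h]
      change U (r • U.symm ξ) = r • (ξ : Cn n)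
      rw [← Complex.coe_smul, ← Complex.coe_smul, map_smul, U.apply_symm_apply]
  exact key.smul_measure _

theorem integral_sphere_comp_unitary {n : ℕ} {E : Type*} [NormedAddCommGroup E] [NormedSpace ℝ E]
    (U : Cn n ≃ₗᵢ[ℂ] Cn n) (f : Cn n → E) :
    ∫ ξ : sphere (0 : Cn n) 1, f (U ξ) ∂sphereMeasure n
      = ∫ ξ : sphere (0 : Cn n) 1, f ξ ∂sphereMeasure n :=
  (measurePreserving_sphereHomeo U).integral_comp (sphereHomeo U).measurableEmbedding
    (fun ξ : sphere (0 : Cn n) 1 => f ξ)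

/-- The cone over a point lies in a real line, which is null because the real dimension is `2n ≥ 2`.
This lets pointwise convergence away from one boundary point count as almost everywhere convergence.
-/
theorem sphereMeasure_singleton {n : ℕ} [NeZero n] (ζ : sphere (0 : Cn n) 1) :
    sphereMeasure n {ζ} = 0 := by
  have h : (volume : Measure (Cn n)).toSphere {ζ} = 0 := by
    rw [Measure.toSphere_apply' _ (measurableSet_singleton _)]
    refine mul_eq_zero_of_right _ (measure_mono_null (t := (Submodule.span ℝ {(ζ : Cn n)} : Set _))
      ?_ (Measure.addHaar_submodule _ _ ?_))
    · rintro x ⟨r, -, y, ⟨ξ, rfl, rfl⟩, rfl⟩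
      exact Submodule.smul_mem _ _ (Submodule.mem_span_singleton_self _)
    · intro h
      have h1 : Module.finrank ℝ (Submodule.span ℝ {(ζ : Cn n)}) ≤ 1 :=
        (finrank_span_le_card _).trans (by simp)
      rw [h, finrank_top, finrank_real_Cn] at h1
      have := NeZero.pos n
      omega
  rw [sphereMeasure, Measure.smul_apply, h, smul_zero]

/-- Integration in polar coordinates against a Gaussian weight of a function that is positively
homogeneous of even degree. -/
theorem integral_homogeneous_mul_exp {n : ℕ} [NeZero n] (k : ℕ) (h : Cn n → ℝ)
    (hh : ∀ (r : ℝ) (x : Cn n), 0 < r → h (r • x) = r ^ (2 * k) * h x) :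
    ∫ x : Cn n, h x * Real.exp (-‖x‖ ^ 2) =
      (∫ ξ : sphere (0 : Cn n) 1, h ξ ∂(volume : Measure (Cn n)).toSphere) *
        (((n + k - 1).factorial : ℝ) / 2) := by
  have hpos := NeZero.pos n
  have hmp := Measure.measurePreserving_homeomorphUnitSphereProd (volume : Measure (Cn n))
  have h1 : ∫ x : Cn n, h x * Real.exp (-‖x‖ ^ 2) =
      ∫ x : ({0}ᶜ : Set (Cn n)), h x * Real.exp (-‖(x : Cn n)‖ ^ 2)
        ∂(Measure.comap Subtype.val volume) := by
    rw [integral_subtype_comap (measurableSet_singleton _).compl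
      (fun x : Cn n => h x * Real.exp (-‖x‖ ^ 2)), restrict_compl_singleton]
  rw [h1, ← hmp.symm (homeomorphUnitSphereProd (Cn n)).toMeasurableEquiv |>.integral_comp
    (homeomorphUnitSphereProd (Cn n)).toMeasurableEquiv.symm.measurableEmbedding]
  have h2 : ∀ q : sphere (0 : Cn n) 1 × Ioi (0 : ℝ),
      h ((homeomorphUnitSphereProd (Cn n)).toMeasurableEquiv.symm q : ({0}ᶜ : Set (Cn n))) *
        Real.exp (-‖(((homeomorphUnitSphereProd (Cn n)).toMeasurableEquiv.symm q :
          ({0}ᶜ : Set (Cn n))) : Cn n)‖ ^ 2)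
      = h q.1 * ((q.2 : ℝ) ^ (2 * k) * Real.exp (-(q.2 : ℝ) ^ 2)) := by
    rintro ⟨ξ, r, hr⟩
    have hr' : 0 < r := hr
    change h (r • (ξ : Cn n)) * Real.exp (-‖r • (ξ : Cn n)‖ ^ 2) = _
    rw [hh r _ hr', norm_smul, norm_eq_of_mem_sphere, mul_one, Real.norm_eq_abs, sq_abs]
    ring
  simp_rw [h2]
  rw [integral_prod_mul (fun ξ : sphere (0 : Cn n) 1 => h ξ)
    (fun r : Ioi (0 : ℝ) => (r : ℝ) ^ (2 * k) * Real.exp (-(r : ℝ) ^ 2))]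
  congr 1
  rw [Measure.volumeIoiPow, integral_withDensity_eq_integral_toReal_smul (by fun_prop) (by simp),
    finrank_real_Cn]
  rw [integral_subtype_comap measurableSet_Ioi (fun r : ℝ =>
    (ENNReal.ofReal (r ^ (2 * n - 1))).toReal • (r ^ (2 * k) * Real.exp (-r ^ 2)))]
  -- The radial factor is `∫ r^{2n-1+2k} e^{-r²} dr = Γ(n+k)/2`.
  have h3 := integral_rpow_mul_exp_neg_rpow (p := 2) (q := 2 * n - 1 + 2 * k) (by norm_num)
    (by have : (1 : ℝ) ≤ n := by exact_mod_cast hpos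
        have : (0 : ℝ) ≤ k := by positivity
        linarith)
  have h4 : (2 * n - 1 + 2 * k + 1 : ℝ) / 2 = ((n + k - 1 : ℕ) : ℝ) + 1 := by
    rw [Nat.cast_sub (by omega)]; push_cast; ring
  rw [h4, Real.Gamma_nat_eq_factorial] at h3
  rw [div_eq_inv_mul, ← one_div, ← h3]
  refine setIntegral_congr_fun measurableSet_Ioi fun r hr => ?_
  have hr' : (0 : ℝ) < r := hr
  have h5 : (2 * n - 1 + 2 * k : ℝ) = ((2 * n - 1 + 2 * k : ℕ) : ℝ) := by
    push_cast [Nat.cast_sub (show 1 ≤ 2 * n by omega)]; ring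
  rw [ENNReal.toReal_ofReal (by positivity), h5, Real.rpow_natCast, smul_eq_mul, pow_add]
  norm_num
  ring

theorem integral_gaussian_moment (k : ℕ) :
    ∫ z : ℂ, ‖z‖ ^ (2 * k) * Real.exp (-‖z‖ ^ 2) = Real.pi * k.factorial := by
  have h := Complex.integral_rpow_mul_exp_neg_rpow (p := 2) (q := 2 * k) (by norm_num)
    (by have : (0 : ℝ) ≤ k := by positivity
        linarith)
  rw [show (2 * k + 2 : ℝ) / 2 = (k : ℝ) + 1 by ring, Real.Gamma_nat_eq_factorial] at h
  rw [show 2 * Real.pi / 2 = Real.pi by ring] at h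
  rw [← h]
  congr 1; ext z
  rw [show (2 * k : ℝ) = ((2 * k : ℕ) : ℝ) by push_cast; ring, Real.rpow_natCast]
  norm_num

/-- The Gaussian splits over the coordinates. The constant, which includes the ratio of two Haar
measures, is left implicit because only its independence of `i` and `k` matters. -/
theorem exists_integral_coord_mul_exp (n : ℕ) [NeZero n] :
    ∃ C : ℝ, C ≠ 0 ∧ ∀ (i : Fin n) (k : ℕ),
      ∫ x : Cn n, ‖x i‖ ^ (2 * k) * Real.exp (-‖x‖ ^ 2) = C * k.factorial := by
  let e : (Fin n → ℂ) ≃L[ℝ] Cn n :=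
    (PiLp.continuousLinearEquiv 2 ℝ (fun _ : Fin n => ℂ)).symm
  have hHaar : (Measure.map e volume).IsAddHaarMeasure := e.isAddHaarMeasure_map volume
  have hc := Measure.isAddLeftInvariant_eq_smul (Measure.map e volume) (volume : Measure (Cn n))
  set c : ℝ≥0 := Measure.addHaarScalarFactor (Measure.map e volume) (volume : Measure (Cn n))
  have hc0 : (c : ℝ) ≠ 0 := by
    have := Measure.addHaarScalarFactor_pos_of_isAddHaarMeasure (Measure.map e volume)
      (volume : Measure (Cn n))
    exact_mod_cast this.ne'
  refine ⟨(c : ℝ)⁻¹ * Real.pi ^ n, by positivity, fun i k => ?_⟩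
  have h1 : ∫ x : Cn n, ‖x i‖ ^ (2 * k) * Real.exp (-‖x‖ ^ 2) ∂(Measure.map e volume) =
      Real.pi ^ n * k.factorial := by
    have he : MeasurableEmbedding e := e.toHomeomorph.measurableEmbedding
    rw [he.integral_map (g := fun x : Cn n => ‖x i‖ ^ (2 * k) * Real.exp (-‖x‖ ^ 2))]
    have h2 : ∀ x : Fin n → ℂ, ‖e x i‖ ^ (2 * k) * Real.exp (-‖e x‖ ^ 2) =
        ∏ j, (‖x j‖ ^ (2 * (if j = i then k else 0)) * Real.exp (-‖x j‖ ^ 2)) := by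
      intro x
      rw [Finset.prod_mul_distrib, ← Real.exp_sum, EuclideanSpace.norm_sq_eq]
      congr 1
      · rw [Finset.prod_eq_single i (by intro j _ hj; simp [hj]) (by simp)]
        simp [e]
      · simp [e]
    have h4 := integral_fintype_prod_volume_eq_prod (𝕜 := ℝ) (ι := Fin n) (E := fun _ => ℂ)
      (fun j z => ‖z‖ ^ (2 * (if j = i then k else 0)) * Real.exp (-‖z‖ ^ 2))
    simp_rw [h2, h4, integral_gaussian_moment]
    rw [Finset.prod_mul_distrib, Finset.prod_const, Finset.card_univ, Fintype.card_fin,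
      Finset.prod_eq_single i (by intro j _ hj; simp [hj]) (by simp)]
    simp
  rw [hc] at h1
  rw [integral_smul_nnreal_measure, NNReal.smul_def, smul_eq_mul] at h1
  rw [mul_assoc, ← h1, inv_mul_cancel_left₀ hc0]

/-- Polar coordinates turn the Gaussian moments of order `k` and `0` into sphere integrals times
`(n+k-1)!/2` and `(n-1)!/2`. In the quotient of the two the unknown constant cancels. -/
theorem integral_sphere_norm_coord_pow {n : ℕ} [NeZero n] (i : Fin n) (k : ℕ) :
    ∫ ξ : sphere (0 : Cn n) 1, ‖(ξ : Cn n) i‖ ^ (2 * k) ∂sphereMeasure n =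
      ((k + (n - 1)).choose (n - 1) : ℝ)⁻¹ := by
  obtain ⟨C, hC, h⟩ := exists_integral_coord_mul_exp n
  have hpos := NeZero.pos n
  have hk := h i k
  have h0 := h i 0
  rw [integral_homogeneous_mul_exp k (fun x => ‖x i‖ ^ (2 * k))] at hk
  swap
  · intro r x hr
    simp [abs_of_pos hr, mul_pow]
  rw [integral_homogeneous_mul_exp 0 (fun x => ‖x i‖ ^ (2 * 0))] at h0
  swap
  · intro r x hr
    simp
  simp only [mul_zero, pow_zero, integral_const, smul_eq_mul, mul_one, add_zero,
    Nat.factorial_zero, Nat.cast_one] at h0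
  rw [sphereMeasure, integral_smul_measure, ENNReal.toReal_inv, smul_eq_mul]
  change (Measure.real _ univ)⁻¹ * _ = _
  set A := ∫ ξ : sphere (0 : Cn n) 1, ‖(ξ : Cn n) i‖ ^ (2 * k) ∂(volume : Measure (Cn n)).toSphere
  set T := (volume : Measure (Cn n)).toSphere.real univ
  have hT : T ≠ 0 := by
    rintro h'
    rw [h', zero_mul] at h0
    exact hC h0.symm
  have hf : ((n - 1).factorial : ℝ) ≠ 0 := by positivity
  have hf' : ((n + k - 1).factorial : ℝ) ≠ 0 := by positivity
  rw [Nat.add_choose, Nat.cast_div (Nat.factorial_mul_factorial_dvd_factorial_add _ _)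
    (by positivity), show k + (n - 1) = n + k - 1 by omega]
  push_cast
  have hfk : (k.factorial : ℝ) ≠ 0 := by positivity
  field_simp
  have : A * ((n + k - 1).factorial / 2) = T * ((n-1).factorial / 2) * k.factorial := by
    rw [hk, h0]
  linarith

theorem exists_orthonormalBasis_apply_eq {n : ℕ} [NeZero n] {e : Cn n} (he : ‖e‖ = 1) :
    ∃ b : OrthonormalBasis (Fin n) ℂ (Cn n), b 0 = e := by
  have hv : Orthonormal ℂ (({0} : Set (Fin n)).domRestrict (fun _ : Fin n => e)) := by
    refine ⟨fun i => he, fun i j hij => (hij (Subsingleton.elim _ _)).elim⟩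
  obtain ⟨b, hb⟩ := hv.exists_orthonormalBasis_extension_of_card_eq (by simp)
  exact ⟨b, hb 0 rfl⟩

theorem integral_sphere_norm_inner_pow {n : ℕ} [NeZero n] {e : Cn n} (he : ‖e‖ = 1) (k : ℕ) :
    ∫ ξ : sphere (0 : Cn n) 1, ‖inner ℂ e (ξ : Cn n)‖ ^ (2 * k) ∂sphereMeasure n =
      ((k + (n - 1)).choose (n - 1) : ℝ)⁻¹ := by
  obtain ⟨b, rfl⟩ := exists_orthonormalBasis_apply_eq he
  rw [← integral_sphere_norm_coord_pow 0 k,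
    ← integral_sphere_comp_unitary b.repr (fun x : Cn n => ‖x 0‖ ^ (2 * k))]
  simp only [b.repr_apply_apply]

/-! ### The Cauchy–Szegő reproducing formula -/

/-- The unitary map that is the identity on the line `ℂ e` and multiplication by `ζ` on its
orthogonal complement. -/
def rotateOrthogonal {n : ℕ} {e : Cn n} (he : ‖e‖ = 1) {ζ : ℂ} (hζ : ‖ζ‖ = 1) :
    Cn n ≃ₗᵢ[ℂ] Cn n :=
  LinearIsometry.toLinearIsometryEquiv
    { toFun := fun x => inner ℂ e x • e + ζ • (x - inner ℂ e x • e)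
      map_add' := fun x y => by rw [inner_add_right]; module
      map_smul' := fun c x => by rw [inner_smul_right]; simp only [RingHom.id_apply]; module
      norm_map' := fun x => by
        have h0 : inner ℂ (inner ℂ e x • e) (x - inner ℂ e x • e) = 0 := by
          rw [inner_smul_left, inner_sub_right, inner_smul_right, inner_self_eq_norm_sq_to_K, he]
          simp
        have h1 := norm_add_sq_eq_norm_sq_add_norm_sq_of_inner_eq_zero (𝕜 := ℂ)
          (inner ℂ e x • e) (x - inner ℂ e x • e) h0
        have h2 := norm_add_sq_eq_norm_sq_add_norm_sq_of_inner_eq_zero (𝕜 := ℂ)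
          (inner ℂ e x • e) (ζ • (x - inner ℂ e x • e)) (by rw [inner_smul_right, h0, mul_zero])
        rw [add_sub_cancel] at h1
        rw [norm_smul ζ, hζ, one_mul, ← h1] at h2
        exact (mul_self_inj (norm_nonneg _) (norm_nonneg _)).1 h2 } rfl

theorem rotateOrthogonal_apply {n : ℕ} {e : Cn n} (he : ‖e‖ = 1) {ζ : ℂ} (hζ : ‖ζ‖ = 1)
    (x : Cn n) :
    rotateOrthogonal he hζ x = inner ℂ e x • e + ζ • (x - inner ℂ e x • e) := rfl

theorem inner_rotateOrthogonal {n : ℕ} {e : Cn n} (he : ‖e‖ = 1) {ζ : ℂ} (hζ : ‖ζ‖ = 1)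
    (x : Cn n) : inner ℂ e (rotateOrthogonal he hζ x) = inner ℂ e x := by
  rw [rotateOrthogonal_apply, inner_add_right, inner_smul_right, inner_smul_right, inner_sub_right,
    inner_smul_right, inner_self_eq_norm_sq_to_K, he]
  simp

/-- Multiplication by a complex number of modulus one as a unitary map. -/
def smulUnitary (n : ℕ) {ζ : ℂ} (hζ : ‖ζ‖ = 1) : Cn n ≃ₗᵢ[ℂ] Cn n :=
  LinearIsometry.toLinearIsometryEquiv
    { toFun := fun x => ζ • x
      map_add' := fun x y => smul_add _ _ _
      map_smul' := fun c x => smul_comm _ _ _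
      norm_map' := fun x => by
        change ‖ζ • x‖ = ‖x‖
        rw [norm_smul, hζ, one_mul] } rfl

theorem integrable_sphere_of_continuous {n : ℕ} [NeZero n] {E : Type*} [NormedAddCommGroup E]
    {f : sphere (0 : Cn n) 1 → E} (hf : Continuous f) :
    Integrable f (sphereMeasure n) := by
  exact hf.integrable_of_hasCompactSupport (HasCompactSupport.of_compactSpace f)

theorem norm_inner_le_one {n : ℕ} {e : Cn n} (he : ‖e‖ = 1) (ξ : sphere (0 : Cn n) 1) :
    ‖inner ℂ e (ξ : Cn n)‖ ≤ 1 := by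
  simpa [he] using norm_inner_le_norm (𝕜 := ℂ) e (ξ : Cn n)

/-- Maximum modulus principle. It keeps the whole disc obtained by scaling the component of `ξ`
orthogonal to `e` inside the domain of holomorphy. -/
theorem norm_add_smul_le_of_unit_circle {E : Type*} [NormedAddCommGroup E] [NormedSpace ℂ E]
    {a b : E} {C : ℝ} (h : ∀ c : ℂ, ‖c‖ = 1 → ‖a + c • b‖ ≤ C) {ζ : ℂ} (hζ : ‖ζ‖ ≤ 1) :
    ‖a + ζ • b‖ ≤ C :=
  Complex.norm_le_of_forall_mem_frontier_norm_le (f := fun c : ℂ => a + c • b)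
    (U := ball 0 1) isBounded_ball (Differentiable.diffContOnCl (by fun_prop)) (C := C)
    (fun z hz => h z (by rw [frontier_ball _ one_ne_zero] at hz; simpa using hz))
    (z := ζ) (by rw [closure_ball _ one_ne_zero]; simpa using hζ)

/-- Integrals against functions of `⟨e, ξ⟩` only see the restriction to the complex line `ℂ e`. -/
theorem integral_sphere_mul_inner_eq_slice {n : ℕ} [NeZero n] {e : Cn n} (he : ‖e‖ = 1)
    {F : Cn n → ℂ} {R : ℝ} (hR : 1 < R) (hF : DifferentiableOn ℂ F (ball 0 R))
    {k : ℂ → ℂ} (hk : Continuous fun ξ : sphere (0 : Cn n) 1 => k (inner ℂ e (ξ : Cn n))) :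
    ∫ ξ : sphere (0 : Cn n) 1, F ξ * k (inner ℂ e (ξ : Cn n)) ∂sphereMeasure n =
    ∫ ξ : sphere (0 : Cn n) 1, F (inner ℂ e (ξ : Cn n) • e) * k (inner ℂ e (ξ : Cn n))
      ∂sphereMeasure n := by
  set σ := sphereMeasure n
  obtain ⟨V, hV⟩ : ∃ V : ℂ → sphere (0 : Cn n) 1 → Cn n, ∀ ζ ξ, V ζ ξ =
    inner ℂ e (ξ : Cn n) • e + ζ • ((ξ : Cn n) - inner ℂ e (ξ : Cn n) • e) :=
    ⟨fun ζ ξ => _, fun _ _ => rfl⟩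
  have hVrot : ∀ (ζ : ℂ) (hζ : ‖ζ‖ = 1) ξ, V ζ ξ = rotateOrthogonal he hζ ξ :=
    fun _ _ _ => hV _ _
  have hball : ∀ ζ : ℂ, ‖ζ‖ = 1 → ∀ ξ, V ζ ξ ∈ ball (0 : Cn n) R := by
    intro ζ hζ ξ
    rw [hVrot ζ hζ, mem_ball_zero_iff, LinearIsometryEquiv.norm_map, norm_eq_of_mem_sphere]
    exact hR
  have hVcont : Continuous fun q : ℂ × sphere (0 : Cn n) 1 => V q.1 q.2 := by
    simp only [hV]; fun_prop
  have hcirc : ∀ θ : ℝ, ‖circleMap 0 1 θ‖ = 1 := fun θ => by simp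
  set I := ∫ ξ : sphere (0 : Cn n) 1, F ξ * k (inner ℂ e (ξ : Cn n)) ∂σ
  -- Rotating the orthogonal complement of `e` preserves both the measure and `⟨e, ξ⟩`, so the
  -- integral does not depend on `θ`.
  have hrot : ∀ θ : ℝ, ∫ ξ, F (V (circleMap 0 1 θ) ξ) * k (inner ℂ e (ξ : Cn n)) ∂σ = I := by
    intro θ
    refine Eq.trans ?_ (integral_sphere_comp_unitary (rotateOrthogonal he (hcirc θ))
      (fun x => F x * k (inner ℂ e x)))
    refine integral_congr_ae (Eventually.of_forall fun ξ => ?_)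
    simp only [inner_rotateOrthogonal, hVrot _ (hcirc θ)]
  have hGcont : Continuous fun q : ℝ × sphere (0 : Cn n) 1 =>
      F (V (circleMap 0 1 q.1) q.2) * k (inner ℂ e (q.2 : Cn n)) := by
    refine Continuous.mul (hF.continuousOn.comp_continuous ?_ fun q => hball _ (hcirc _) _)
      (hk.comp continuous_snd)
    exact Continuous.comp (g := fun q : ℂ × sphere (0 : Cn n) 1 => V q.1 q.2)
      (f := fun q : ℝ × sphere (0 : Cn n) 1 => (circleMap 0 1 q.1, q.2)) hVcont
      (((continuous_circleMap 0 1).comp continuous_fst).prodMk continuous_snd)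
  -- Mean value property on the disc `ζ ↦ V ζ ξ`, whose centre is the projection of `ξ` to `ℂ e`.
  -- Averaging over `θ` and exchanging integrals then replaces `F ξ` by its value at that
  -- projection.
  have hmean : ∀ ξ : sphere (0 : Cn n) 1,
      Real.circleAverage (fun ζ => F (V ζ ξ)) 0 1 = F (inner ℂ e (ξ : Cn n) • e) := by
    intro ξ
    have hd : DifferentiableOn ℂ (fun ζ => F (V ζ ξ)) (closure (ball 0 |1|)) := by
      rw [abs_one, closure_ball _ one_ne_zero]
      refine hF.comp (by simp only [hV]; fun_prop) fun ζ hζ => ?_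
      have hζ' : ‖ζ‖ ≤ 1 := by simpa using hζ
      change V ζ ξ ∈ ball (0 : Cn n) R
      rw [mem_ball_zero_iff, hV]
      refine (norm_add_smul_le_of_unit_circle (fun c hc => ?_) hζ').trans_lt hR
      rw [← hV, hVrot c hc, LinearIsometryEquiv.norm_map, norm_eq_of_mem_sphere]
    have := hd.diffContOnCl.circleAverage
    rw [this]
    simp [hV]
  have hswap : ∫ θ in (0 : ℝ)..2 * Real.pi, ∫ ξ, F (V (circleMap 0 1 θ) ξ) *
      k (inner ℂ e (ξ : Cn n)) ∂σ = ∫ ξ, (∫ θ in (0 : ℝ)..2 * Real.pi,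
        F (V (circleMap 0 1 θ) ξ) * k (inner ℂ e (ξ : Cn n))) ∂σ := by
    refine intervalIntegral_integral_swap ?_
    obtain ⟨C, hC⟩ := (isCompact_closedBall (0 : Cn n) 1).exists_bound_of_continuousOn
      (hF.continuousOn.mono (closedBall_subset_ball hR))
    obtain ⟨D, hD⟩ := (isCompact_univ (X := sphere (0 : Cn n) 1)).exists_bound_of_continuousOn
      hk.continuousOn
    have : IsFiniteMeasure ((volume : Measure ℝ).restrict (uIoc 0 (2 * Real.pi))) :=
      ⟨by simp [uIoc]⟩
    refine Integrable.of_bound hGcont.aestronglyMeasurable (C * D) (Eventually.of_forall fun q => ?_)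
    have h1 : ‖F (V (circleMap 0 1 q.1) q.2)‖ ≤ C := hC _ (by
      rw [hVrot _ (hcirc _), mem_closedBall_zero_iff, LinearIsometryEquiv.norm_map,
        norm_eq_of_mem_sphere])
    rw [Function.uncurry, norm_mul]
    exact mul_le_mul h1 (hD _ (mem_univ _)) (norm_nonneg _) ((norm_nonneg _).trans h1)
  simp only [hrot, intervalIntegral.integral_const, sub_zero] at hswap
  have h2π : (2 * Real.pi) ≠ 0 := by positivity
  have : I = (2 * Real.pi)⁻¹ • ((2 * Real.pi) • I) := by rw [inv_smul_smul₀ h2π]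
  rw [this, hswap, ← integral_smul]
  refine integral_congr_ae (Eventually.of_forall fun ξ => ?_)
  simp only
  rw [intervalIntegral.integral_mul_const, ← hmean, Real.circleAverage, smul_mul_assoc]


theorem integral_sphere_inner_pow_mul_conj_pow {n : ℕ} [NeZero n] {e : Cn n} (he : ‖e‖ = 1)
    (j k : ℕ) :
    ∫ ξ : sphere (0 : Cn n) 1, inner ℂ e (ξ : Cn n) ^ j *
      (starRingEnd ℂ (inner ℂ e (ξ : Cn n))) ^ k ∂sphereMeasure n =
      if j = k then (((k + (n - 1)).choose (n - 1) : ℝ)⁻¹ : ℂ) else 0 := by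
  split_ifs with hjk
  · subst hjk
    rw [← Complex.ofReal_inv, ← integral_sphere_norm_inner_pow he j, ← integral_complex_ofReal]
    refine integral_congr_ae (Eventually.of_forall fun ξ => ?_)
    simp only
    rw [← mul_pow, Complex.mul_conj, Complex.normSq_eq_norm_sq, pow_mul]
    push_cast
    rfl
  · have hjk' : ((j : ℂ) - k) ≠ 0 := sub_ne_zero.2 (by exact_mod_cast hjk)
    -- With this angle `e^{iθ(j-k)} = -1`, so rotation invariance equates the integral with its
    -- negative.
    set θ : ℝ := Real.pi / ((j : ℝ) - k) with hθ
    have hζ : ‖Complex.exp (θ * Complex.I)‖ = 1 := Complex.norm_exp_ofReal_mul_I θ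
    have h1 : Complex.exp (θ * Complex.I) ^ j * (starRingEnd ℂ (Complex.exp (θ * Complex.I))) ^ k
        = -1 := by
      rw [← Complex.exp_conj, ← Complex.exp_nat_mul, ← Complex.exp_nat_mul, ← Complex.exp_add,
        ← Complex.exp_pi_mul_I]
      congr 1
      simp only [map_mul, Complex.conj_ofReal, Complex.conj_I, hθ]
      push_cast
      field_simp
      ring
    have h2 := integral_sphere_comp_unitary (smulUnitary n hζ)
      (fun x : Cn n => inner ℂ e x ^ j * (starRingEnd ℂ (inner ℂ e x)) ^ k)
    have h3 : ∀ x : Cn n, inner ℂ e (smulUnitary n hζ x) ^ j *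
        (starRingEnd ℂ (inner ℂ e (smulUnitary n hζ x))) ^ k =
        (-1) * (inner ℂ e x ^ j * (starRingEnd ℂ (inner ℂ e x)) ^ k) := by
      intro x
      change inner ℂ e (Complex.exp (θ * Complex.I) • x) ^ j *
        (starRingEnd ℂ (inner ℂ e (Complex.exp (θ * Complex.I) • x))) ^ k = _
      rw [inner_smul_right, ← h1, map_mul]
      ring
    simp only [h3] at h2
    rw [integral_const_mul] at h2
    linear_combination (-1 / 2 : ℂ) * h2

/-- Expand the kernel in the binomial series `∑ C(k+n-1, n-1) (t s̄)^k`, uniformly summable since `t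
< 1`. Orthogonality leaves only `k = j`, where the coefficient is the reciprocal of the moment. -/
theorem integral_sphere_inner_pow_mul_kernel {n : ℕ} [NeZero n] {e : Cn n} (he : ‖e‖ = 1)
    {t : ℝ} (ht0 : 0 ≤ t) (ht1 : t < 1) (j : ℕ) :
    ∫ ξ : sphere (0 : Cn n) 1, inner ℂ e (ξ : Cn n) ^ j *
      (1 / (1 - t * starRingEnd ℂ (inner ℂ e (ξ : Cn n))) ^ n) ∂sphereMeasure n = (t : ℂ) ^ j := by
  have hn : n - 1 + 1 = n := Nat.sub_add_cancel (NeZero.pos n)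
  set s : sphere (0 : Cn n) 1 → ℂ := fun ξ => inner ℂ e (ξ : Cn n) with hs
  have hsc : Continuous s := by simp only [hs]; fun_prop
  have hs1 : ∀ ξ, ‖s ξ‖ ≤ 1 := norm_inner_le_one he
  set a : ℕ → sphere (0 : Cn n) 1 → ℂ := fun k ξ =>
    s ξ ^ j * (((k + (n - 1)).choose (n - 1) : ℂ) * (t * starRingEnd ℂ (s ξ)) ^ k) with ha
  have hac : ∀ k, Continuous (a k) := fun k => by
    simp only [ha]
    exact (hsc.pow j).mul (continuous_const.mul
      ((continuous_const.mul (Complex.continuous_conj.comp hsc)).pow k))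
  have hnorm : ∀ k ξ, ‖a k ξ‖ ≤ (k + (n - 1)).choose (n - 1) * t ^ k := by
    intro k ξ
    simp only [ha, norm_mul, norm_pow, Complex.norm_natCast, Complex.norm_real, RCLike.norm_conj,
      Real.norm_eq_abs, abs_of_nonneg ht0]
    have h1 : ‖s ξ‖ ^ j ≤ 1 := pow_le_one₀ (norm_nonneg _) (hs1 ξ)
    have h2 : (t * ‖s ξ‖) ^ k ≤ t ^ k := by
      gcongr
      exact mul_le_of_le_one_right ht0 (hs1 ξ)
    calc _ ≤ 1 * (((k + (n - 1)).choose (n - 1) : ℝ) * t ^ k) := by gcongr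
      _ = _ := one_mul _
  have hsum : Summable fun k : ℕ => ((k + (n - 1)).choose (n - 1) : ℝ) * t ^ k :=
    summable_choose_mul_geometric_of_norm_lt_one (n - 1)
      (by rwa [Real.norm_eq_abs, abs_of_nonneg ht0])
  have hint := hasSum_integral_of_summable_integral_norm (μ := sphereMeasure n) (F := a)
    (fun k => integrable_sphere_of_continuous (hac k))
    (hsum.of_nonneg_of_le (fun k => integral_nonneg fun ξ => norm_nonneg _) fun k => by
      have := integral_mono (μ := sphereMeasure n)
        (integrable_sphere_of_continuous (hac k).norm) (integrable_const _) (hnorm k)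
      simpa using this)
  have htsum : ∀ ξ, ∑' k, a k ξ = s ξ ^ j * (1 / (1 - t * starRingEnd ℂ (s ξ)) ^ n) := by
    intro ξ
    have h1 : ‖(t : ℂ) * starRingEnd ℂ (s ξ)‖ < 1 := by
      rw [norm_mul, RCLike.norm_conj, Complex.norm_real, Real.norm_eq_abs, abs_of_nonneg ht0]
      exact (mul_le_of_le_one_right ht0 (hs1 ξ)).trans_lt ht1
    have h2 := (hasSum_choose_mul_geometric_of_norm_lt_one (n - 1) h1).mul_left (s ξ ^ j)
    rw [hn] at h2
    exact h2.tsum_eq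
  simp only [htsum] at hint
  refine hint.unique ?_
  have hterm : ∀ k, ∫ ξ, a k ξ ∂sphereMeasure n = if k = j then (t : ℂ) ^ j else 0 := by
    intro k
    have h1 : ∀ ξ, a k ξ = (((k + (n - 1)).choose (n - 1) : ℂ) * t ^ k) *
        (s ξ ^ j * starRingEnd ℂ (s ξ) ^ k) := by
      intro ξ; simp only [ha]; ring
    simp only [h1]
    rw [integral_const_mul, integral_sphere_inner_pow_mul_conj_pow he]
    by_cases hjk : j = k
    · subst hjk
      have h0 : ((j + (n - 1)).choose (n - 1) : ℂ) ≠ 0 := by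
        exact_mod_cast (Nat.choose_pos (Nat.le_add_left _ _)).ne'
      simp only [if_true, Complex.ofReal_natCast]
      field_simp
    · rw [if_neg hjk, if_neg (Ne.symm hjk), mul_zero]
  simp only [hterm]
  exact hasSum_ite_eq j _

theorem integral_sphere_holomorphic_inner_mul_kernel {n : ℕ} [NeZero n] {e : Cn n} (he : ‖e‖ = 1)
    {t : ℝ} (ht0 : 0 ≤ t) (ht1 : t < 1) {g : ℂ → ℂ} {R : ℝ} (hR : 1 < R)
    (hg : DifferentiableOn ℂ g (ball 0 R)) :
    ∫ ξ : sphere (0 : Cn n) 1, g (inner ℂ e (ξ : Cn n)) *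
      (1 / (1 - t * starRingEnd ℂ (inner ℂ e (ξ : Cn n))) ^ n) ∂sphereMeasure n = g t := by
  set c : ℕ → ℂ := fun j => (j.factorial : ℂ)⁻¹ * iteratedDeriv j g 0 with hc
  have hser : ∀ z : ℂ, ‖z‖ < R → HasSum (fun j => c j * z ^ j) (g z) := by
    intro z hz
    have := Complex.hasSum_taylorSeries_on_ball hg (z := z) (by simpa using hz)
    refine this.congr_fun fun j => ?_
    simp only [hc, smul_eq_mul, sub_zero]
    ring
  -- The Taylor series converges at `1` because `R > 1`, hence absolutely; this dominates the series
  -- on the sphere, where `|s| ≤ 1`.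
  have hcs : Summable fun j => ‖c j‖ := by
    have := (hser 1 (by simpa using hR)).summable
    simpa using this.norm
  set s : sphere (0 : Cn n) 1 → ℂ := fun ξ => inner ℂ e (ξ : Cn n) with hs
  have hsc : Continuous s := by simp only [hs]; fun_prop
  have hs1 : ∀ ξ, ‖s ξ‖ ≤ 1 := norm_inner_le_one he
  set κ : sphere (0 : Cn n) 1 → ℂ := fun ξ => 1 / (1 - t * starRingEnd ℂ (s ξ)) ^ n with hκ
  have hκc : Continuous κ := by
    simp only [hκ]
    refine continuous_const.div ((continuous_const.sub
      (continuous_const.mul (Complex.continuous_conj.comp hsc))).pow n) fun ξ => ?_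
    refine pow_ne_zero _ (sub_ne_zero.2 fun h => ?_)
    have h1 : ‖(t : ℂ) * starRingEnd ℂ (s ξ)‖ < 1 := by
      rw [norm_mul, RCLike.norm_conj, Complex.norm_real, Real.norm_eq_abs, abs_of_nonneg ht0]
      exact (mul_le_of_le_one_right ht0 (hs1 ξ)).trans_lt ht1
    rw [← h] at h1
    simp at h1
  obtain ⟨D, hD⟩ := (isCompact_univ (X := sphere (0 : Cn n) 1)).exists_bound_of_continuousOn
    hκc.continuousOn
  have hac : ∀ j, Continuous fun ξ => c j * s ξ ^ j * κ ξ := fun j =>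
    (continuous_const.mul (hsc.pow j)).mul hκc
  have hint := hasSum_integral_of_summable_integral_norm (μ := sphereMeasure n)
    (F := fun j ξ => c j * s ξ ^ j * κ ξ)
    (fun k => integrable_sphere_of_continuous (hac k))
    ((hcs.mul_right D).of_nonneg_of_le (fun k => integral_nonneg fun ξ => norm_nonneg _) fun k => by
      have := integral_mono (μ := sphereMeasure n)
        (integrable_sphere_of_continuous (hac k).norm) (integrable_const (‖c k‖ * D)) (fun ξ => by
          simp only [norm_mul, norm_pow]
          have h1 : ‖s ξ‖ ^ k ≤ 1 := pow_le_one₀ (norm_nonneg _) (hs1 ξ)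
          calc ‖c k‖ * ‖s ξ‖ ^ k * ‖κ ξ‖ ≤ ‖c k‖ * 1 * D := by
                gcongr
                exact hD ξ (mem_univ _)
            _ = _ := by rw [mul_one])
      simpa using this)
  have htsum : ∀ ξ, ∑' j, c j * s ξ ^ j * κ ξ = g (s ξ) * κ ξ := fun ξ =>
    ((hser (s ξ) ((hs1 ξ).trans_lt hR)).mul_right _).tsum_eq
  simp only [htsum] at hint
  refine hint.unique ?_
  have hterm : ∀ j, ∫ ξ, c j * s ξ ^ j * κ ξ ∂sphereMeasure n = c j * (t : ℂ) ^ j := by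
    intro j
    simp only [mul_assoc]
    rw [integral_const_mul, integral_sphere_inner_pow_mul_kernel he ht0 ht1]
  simp only [hterm]
  exact hser t (by
    rw [Complex.norm_real, Real.norm_eq_abs, abs_of_nonneg ht0]; exact ht1.trans hR)

/-- The **Cauchy–Szegő formula**. -/
theorem integral_sphere_mul_szego {n : ℕ} [NeZero n] {F : Cn n → ℂ} {R : ℝ} (hR : 1 < R)
    (hF : DifferentiableOn ℂ F (ball 0 R)) {w : Cn n} (hw : ‖w‖ < 1) :
    ∫ ξ : sphere (0 : Cn n) 1, F ξ * (1 / (1 - inner ℂ (ξ : Cn n) w) ^ n) ∂sphereMeasure n =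
      F w := by
  -- With `e` in the direction of `w` (arbitrary if `w = 0`), the Szegő kernel depends on `ξ` only
  -- through `⟨e, ξ⟩`, so the slice formula reduces the claim to one variable.
  obtain ⟨e, he, hwe⟩ : ∃ e : Cn n, ‖e‖ = 1 ∧ w = (‖w‖ : ℂ) • e := by
    by_cases h0 : w = 0
    · obtain ⟨e, he⟩ := exists_norm_eq (Cn n) zero_le_one
      exact ⟨e, he, by simp [h0]⟩
    · have h0' : (‖w‖ : ℂ) ≠ 0 := by exact_mod_cast norm_ne_zero_iff.2 h0
      refine ⟨(‖w‖ : ℂ)⁻¹ • w, ?_, by rw [smul_inv_smul₀ h0']⟩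
      rw [norm_smul, norm_inv, Complex.norm_real, norm_norm,
        inv_mul_cancel₀ (norm_ne_zero_iff.2 h0)]
  have hin : ∀ x : Cn n, inner ℂ x w = ‖w‖ * starRingEnd ℂ (inner ℂ e x) := by
    intro x
    conv_lhs => rw [hwe]
    rw [inner_smul_right, inner_conj_symm]
  simp only [hin]
  set t := ‖w‖
  have ht0 : 0 ≤ t := norm_nonneg w
  rw [integral_sphere_mul_inner_eq_slice he hR hF
    (k := fun s => 1 / (1 - t * starRingEnd ℂ s) ^ n)]
  · rw [integral_sphere_holomorphic_inner_mul_kernel he ht0 hw (g := fun s => F (s • e)) hR, ← hwe]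
    refine hF.comp (by fun_prop) fun s hs => ?_
    rw [mem_ball_zero_iff] at hs ⊢
    rwa [norm_smul, he, mul_one]
  · have hsc : Continuous fun ξ : sphere (0 : Cn n) 1 => inner ℂ e (ξ : Cn n) := by fun_prop
    refine continuous_const.div ((continuous_const.sub
      (continuous_const.mul (Complex.continuous_conj.comp hsc))).pow n) fun ξ => ?_
    refine pow_ne_zero _ (sub_ne_zero.2 fun h => ?_)
    have h1 : ‖(t : ℂ) * starRingEnd ℂ (inner ℂ e (ξ : Cn n))‖ < 1 := by
      rw [norm_mul, RCLike.norm_conj, Complex.norm_real, Real.norm_eq_abs, abs_of_nonneg ht0]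
      exact (mul_le_of_le_one_right ht0 (norm_inner_le_one he ξ)).trans_lt hw
    rw [← h] at h1
    simp at h1

/-! ### Kernel functions -/

/-- The function `z ↦ 1 - ⟨z, w⟩`, whose powers are the kernel functions of the ball. -/
def kernelBase {n : ℕ} (w z : Cn n) : ℂ := 1 - inner ℂ w z

section KernelBase

variable {n : ℕ} {w z : Cn n}

theorem differentiable_kernelBase : Differentiable ℂ (kernelBase w) :=
  (differentiable_const 1).sub (innerSL ℂ w).differentiable

/-- A positive real part keeps the base off the branch cut, so its complex powers are holomorphic.
-/
theorem re_kernelBase_pos (h : ‖w‖ * ‖z‖ < 1) : 0 < (kernelBase w z).re := by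
  have h1 : (inner ℂ w z).re ≤ ‖w‖ * ‖z‖ := (Complex.re_le_norm _).trans (norm_inner_le_norm _ _)
  simp only [kernelBase, Complex.sub_re, Complex.one_re]
  linarith

theorem kernelBase_mem_slitPlane (h : ‖w‖ * ‖z‖ < 1) : kernelBase w z ∈ Complex.slitPlane :=
  Or.inl (re_kernelBase_pos h)

theorem kernelBase_ne_zero (h : ‖w‖ * ‖z‖ < 1) : kernelBase w z ≠ 0 :=
  Complex.slitPlane_ne_zero (kernelBase_mem_slitPlane h)

theorem kernelBase_self (w : Cn n) : kernelBase w w = ((1 - ‖w‖ ^ 2 : ℝ) : ℂ) := by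
  rw [kernelBase, inner_self_eq_norm_sq_to_K]; push_cast; rfl

theorem kernelBase_smul (r : ℝ) : kernelBase w (r • z) = kernelBase (r • w) z := by
  rw [kernelBase, kernelBase, ← Complex.coe_smul, ← Complex.coe_smul, inner_smul_left,
    inner_smul_right, Complex.conj_ofReal]

theorem conj_kernelBase : 1 - inner ℂ z w = starRingEnd ℂ (kernelBase w z) := by
  rw [kernelBase, map_sub, map_one, inner_conj_symm]

theorem one_sub_norm_sq_pos (hw : ‖w‖ < 1) : 0 < 1 - ‖w‖ ^ 2 := by
  nlinarith [norm_nonneg w]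

/-- The radius `2 / (1 + ‖w‖)` exceeds one yet stays below `1 / ‖w‖`, giving the room beyond the
closed ball that the Szegő formula requires. -/
theorem mul_norm_lt_one_of_mem_ball (hw : ‖w‖ < 1) (hz : z ∈ ball (0 : Cn n) (2 / (1 + ‖w‖))) :
    ‖w‖ * ‖z‖ < 1 := by
  rw [mem_ball_zero_iff, lt_div_iff₀ (by positivity)] at hz
  nlinarith [norm_nonneg w, norm_nonneg z]

theorem one_lt_two_div_one_add_norm (hw : ‖w‖ < 1) : 1 < 2 / (1 + ‖w‖) := by
  rw [lt_div_iff₀ (by positivity)]; linarith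

theorem differentiableOn_kernelBase_cpow (c : ℂ) {s : Set (Cn n)}
    (h : ∀ z ∈ s, ‖w‖ * ‖z‖ < 1) : DifferentiableOn ℂ (fun z => kernelBase w z ^ c) s :=
  differentiable_kernelBase.differentiableOn.cpow_const fun z hz => kernelBase_mem_slitPlane (h z hz)

theorem norm_mul_sphere_lt_one (hw : ‖w‖ < 1) (ξ : sphere (0 : Cn n) 1) :
    ‖w‖ * ‖(ξ : Cn n)‖ < 1 := by
  rwa [norm_eq_of_mem_sphere, mul_one]

theorem continuous_norm_kernelBase_rpow (hw : ‖w‖ < 1) (a : ℝ) :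
    Continuous fun ξ : sphere (0 : Cn n) 1 => ‖kernelBase w (ξ : Cn n)‖ ^ a :=
  ((differentiable_kernelBase.continuous.comp continuous_subtype_val).norm).rpow_const
    fun ξ => Or.inl (norm_ne_zero_iff.2 (kernelBase_ne_zero (norm_mul_sphere_lt_one hw ξ)))

/-- Reproduce `F(z) = (1 - ⟨z, w⟩)^{-n}` at `w`: on the sphere `F` times the Szegő kernel is `|1 -
⟨ξ, w⟩|^{-2n}`. -/
theorem integral_norm_kernelBase [NeZero n] (hw : ‖w‖ < 1) :
    ∫ ξ : sphere (0 : Cn n) 1, ‖kernelBase w (ξ : Cn n)‖ ^ (-(2 * n) : ℝ) ∂sphereMeasure n =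
      (1 - ‖w‖ ^ 2) ^ (-n : ℝ) := by
  have h := integral_sphere_mul_szego (F := fun z => (kernelBase w z ^ n)⁻¹)
    (one_lt_two_div_one_add_norm hw)
    ((differentiable_kernelBase.differentiableOn.pow n).inv fun z hz =>
      pow_ne_zero _ (kernelBase_ne_zero (mul_norm_lt_one_of_mem_ball hw hz))) hw
  have h1 : ∀ ξ : sphere (0 : Cn n) 1, (kernelBase w (ξ : Cn n) ^ n)⁻¹ *
      (1 / (1 - inner ℂ (ξ : Cn n) w) ^ n) =
      ((‖kernelBase w (ξ : Cn n)‖ ^ (-(2 * n) : ℝ) : ℝ) : ℂ) := by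
    intro ξ
    rw [conj_kernelBase, one_div, ← mul_inv, ← mul_pow, Complex.mul_conj,
      Complex.normSq_eq_norm_sq, Real.rpow_neg (norm_nonneg _),
      show (2 * n : ℝ) = ((2 * n : ℕ) : ℝ) by push_cast; ring, Real.rpow_natCast, pow_mul]
    push_cast
    rfl
  simp only [h1] at h
  rw [integral_complex_ofReal, kernelBase_self] at h
  rw [Real.rpow_neg (one_sub_norm_sq_pos hw).le, Real.rpow_natCast]
  exact_mod_cast h

end KernelBase

/-! ### The Hardy norm through integrals -/

section HardyNorm

variable {n : ℕ} {p : ℝ≥0∞}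

theorem toReal_exponent_pos [Fact (1 ≤ p)] (hp : p ≠ ∞) : 0 < p.toReal :=
  ENNReal.toReal_pos (zero_lt_one.trans_le Fact.out).ne' hp

theorem eLpNorm_sphere_eq [NeZero n] [Fact (1 ≤ p)] (hp : p ≠ ∞) {E : Type*}
    [NormedAddCommGroup E] {g : sphere (0 : Cn n) 1 → E} (hg : Continuous g) :
    eLpNorm g p (sphereMeasure n) =
      ENNReal.ofReal ((∫ ξ, ‖g ξ‖ ^ p.toReal ∂sphereMeasure n) ^ p.toReal⁻¹) :=
  MemLp.eLpNorm_eq_integral_rpow_norm (zero_lt_one.trans_le Fact.out).ne' hp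
    (hg.memLp_of_hasCompactSupport (HasCompactSupport.of_compactSpace g))

theorem hardyENorm_le_of_integral_le [NeZero n] [Fact (1 ≤ p)] (hp : p ≠ ∞) {f : Cn n → ℂ}
    (hf : f ∈ holomorphicBall n) {C : ℝ} (hC : 0 ≤ C)
    (h : ∀ r ∈ Ioo (0 : ℝ) 1, ∫ ξ : sphere (0 : Cn n) 1, ‖f (r • (ξ : Cn n))‖ ^ p.toReal
      ∂sphereMeasure n ≤ C ^ p.toReal) : hardyENorm n p f ≤ ENNReal.ofReal C := by
  have hq := toReal_exponent_pos hp
  rw [hardyENorm, if_neg hp]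
  refine iSup₂_le fun r hr => ?_
  rw [eLpNorm_sphere_eq hp (continuous_dilate hf hr)]
  refine ENNReal.ofReal_le_ofReal ?_
  calc _ ≤ (C ^ p.toReal) ^ p.toReal⁻¹ := Real.rpow_le_rpow
        (integral_nonneg fun _ => by positivity) (h r hr) (by positivity)
    _ = C := Real.rpow_rpow_inv hC hq.ne'

namespace HardySpace

variable [Fact (1 ≤ p)]

theorem mem_holomorphicBall (f : HardySpace n p) : f.toFun ∈ holomorphicBall n := f.2.1

theorem differentiableOn (f : HardySpace n p) : DifferentiableOn ℂ f.toFun (ball 0 1) := f.2.1.1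

theorem eq_zero_of_notMem (f : HardySpace n p) {z : Cn n} (hz : z ∉ ball (0 : Cn n) 1) :
    f.toFun z = 0 := f.2.1.2 z hz

/-- An element of the Hardy space from a function of finite Hardy norm. -/
def mk (f : Cn n → ℂ) (hf : f ∈ holomorphicBall n) (h : hardyENorm n p f < ∞) : HardySpace n p :=
  ⟨f, hf, h⟩

@[ext] theorem ext {f g : HardySpace n p} (h : f.toFun = g.toFun) : f = g := Subtype.ext h

@[simp] theorem toFun_mk (f : Cn n → ℂ) (hf : f ∈ holomorphicBall n) (h : hardyENorm n p f < ∞) :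
    (mk f hf h).toFun = f := rfl

@[simp] theorem toFun_add (f g : HardySpace n p) (z : Cn n) :
    (f + g).toFun z = f.toFun z + g.toFun z := rfl

@[simp] theorem toFun_smul (c : ℂ) (f : HardySpace n p) (z : Cn n) :
    (c • f).toFun z = c * f.toFun z := rfl

@[simp] theorem toFun_sub (f g : HardySpace n p) (z : Cn n) :
    (f - g).toFun z = f.toFun z - g.toFun z := rfl

theorem norm_eq (f : HardySpace n p) : ‖f‖ = (hardyENorm n p f.toFun).toReal := rfl

theorem hardyENorm_eq (f : HardySpace n p) : hardyENorm n p f.toFun = ENNReal.ofReal ‖f‖ := by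
  rw [norm_eq]
  exact (ENNReal.ofReal_toReal f.2.2.ne).symm

theorem norm_le_of_hardyENorm_le {f : HardySpace n p} {C : ℝ} (hC : 0 ≤ C)
    (h : hardyENorm n p f.toFun ≤ ENNReal.ofReal C) : ‖f‖ ≤ C :=
  ENNReal.toReal_le_of_le_ofReal hC h

theorem hardyENorm_top_le {f : Cn n → ℂ} {C : ℝ}
    (h : ∀ z ∈ ball (0 : Cn n) 1, ‖f z‖ ≤ C) : hardyENorm n ∞ f ≤ ENNReal.ofReal C := by
  rw [hardyENorm, if_pos rfl]
  refine iSup₂_le fun z hz => ?_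
  rw [← ofReal_norm]
  exact ENNReal.ofReal_le_ofReal (h z hz)

theorem norm_top_le {f : HardySpace n ∞} {C : ℝ} (hC : 0 ≤ C)
    (h : ∀ z ∈ ball (0 : Cn n) 1, ‖f.toFun z‖ ≤ C) : ‖f‖ ≤ C :=
  norm_le_of_hardyENorm_le hC (hardyENorm_top_le h)

variable [NeZero n]

theorem integral_rpow_le (hp : p ≠ ∞) (f : HardySpace n p) {r : ℝ} (hr : r ∈ Ioo (0 : ℝ) 1) :
    ∫ ξ : sphere (0 : Cn n) 1, ‖f.toFun (r • (ξ : Cn n))‖ ^ p.toReal ∂sphereMeasure n ≤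
      ‖f‖ ^ p.toReal := by
  have hq := toReal_exponent_pos hp
  have h1 : eLpNorm (fun ξ : sphere (0 : Cn n) 1 => f.toFun (r • (ξ : Cn n))) p (sphereMeasure n) ≤
      ENNReal.ofReal ‖f‖ := by
    rw [← hardyENorm_eq, hardyENorm, if_neg hp]
    exact le_iSup₂ (f := fun r (_ : r ∈ Ioo (0 : ℝ) 1) => eLpNorm
      (fun ξ : sphere (0 : Cn n) 1 => f.toFun (r • (ξ : Cn n))) p (sphereMeasure n)) r hr
  rw [eLpNorm_sphere_eq hp (continuous_dilate f.mem_holomorphicBall hr),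
    ENNReal.ofReal_le_ofReal_iff (norm_nonneg _)] at h1
  have h0 : 0 ≤ ∫ ξ : sphere (0 : Cn n) 1, ‖f.toFun (r • (ξ : Cn n))‖ ^ p.toReal
    ∂sphereMeasure n := integral_nonneg fun _ => by positivity
  calc _ = ((∫ ξ : sphere (0 : Cn n) 1, ‖f.toFun (r • (ξ : Cn n))‖ ^ p.toReal
        ∂sphereMeasure n) ^ p.toReal⁻¹) ^ p.toReal := (Real.rpow_inv_rpow h0 hq.ne').symm
    _ ≤ _ := Real.rpow_le_rpow (by positivity) h1 hq.le

theorem norm_apply_le_norm (f : HardySpace n ∞) (z : Cn n) : ‖f.toFun z‖ ≤ ‖f‖ := by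
  by_cases hz : z ∈ ball (0 : Cn n) 1
  · have h1 : ‖f.toFun z‖ₑ ≤ ENNReal.ofReal ‖f‖ := by
      rw [← hardyENorm_eq, hardyENorm, if_pos rfl]
      exact le_iSup₂ (f := fun z (_ : z ∈ ball (0 : Cn n) 1) => ‖f.toFun z‖ₑ) z hz
    rwa [← ofReal_norm, ENNReal.ofReal_le_ofReal_iff (norm_nonneg _)] at h1
  · rw [f.eq_zero_of_notMem hz, norm_zero]; exact norm_nonneg _

end HardySpace

/-- The sharp growth estimate through the mean over a sphere of radius `r < 1`. -/
theorem norm_dilate_le_rpow_mul_integral [NeZero n] {q : ℝ} (hq : 1 < q) {f : Cn n → ℂ}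
    (hf : f ∈ holomorphicBall n) {r : ℝ} (hr : r ∈ Ioo (0 : ℝ) 1) {w : Cn n} (hw : ‖w‖ < 1) :
    ‖f (r • w)‖ ≤ (1 - ‖w‖ ^ 2) ^ (-(n / q)) *
      (∫ ξ : sphere (0 : Cn n) 1, ‖f (r • (ξ : Cn n))‖ ^ q ∂sphereMeasure n) ^ (1 / q) := by
  set a := 1 - ‖w‖ ^ 2 with ha
  have ha0 : 0 < a := one_sub_norm_sq_pos hw
  set q' := q.conjExponent with hq'
  have hconj : q.HolderConjugate q' := Real.HolderConjugate.conjExponent hq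
  have hq0 : 0 < q := hconj.pos
  have hq'0 : 0 < q' := hconj.symm.pos
  have hqq : q'⁻¹ = 1 - q⁻¹ := by
    have := hconj.inv_add_inv_eq_one
    linarith
  -- Chosen so that `α + n = 2n/q'`: in Hölder's inequality the `q'`-th power of the kernel factor
  -- then has exponent `-2n`, whose integral is known exactly.
  set α : ℝ := n * (1 - 2 / q) with hα
  -- On this ball both the power of the kernel base and the dilate `f(r ·)` are holomorphic.
  set R := min (2 / (1 + ‖w‖)) r⁻¹ with hR
  have hR1 : 1 < R := lt_min (one_lt_two_div_one_add_norm hw) ((one_lt_inv₀ hr.1).2 hr.2)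
  have hbR : ∀ z ∈ ball (0 : Cn n) R, ‖w‖ * ‖z‖ < 1 := fun z hz =>
    mul_norm_lt_one_of_mem_ball hw (ball_subset_ball (min_le_left _ _) hz)
  have hF : DifferentiableOn ℂ
      (fun z => f (r • z) * kernelBase w z ^ (-α : ℂ)) (ball (0 : Cn n) R) := by
    refine DifferentiableOn.mul (hf.1.comp ?_ fun z hz => ?_)
      (differentiableOn_kernelBase_cpow _ hbR)
    · exact (differentiable_id.const_smul r).differentiableOn
    · have hz' : ‖z‖ < r⁻¹ := (mem_ball_zero_iff.1 hz).trans_le (min_le_right _ _)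
      rw [mem_ball_zero_iff, norm_smul, Real.norm_eq_abs, abs_of_pos hr.1]
      calc r * ‖z‖ < r * r⁻¹ := by gcongr; exact hr.1
        _ = 1 := mul_inv_cancel₀ hr.1.ne'
  have hrep := integral_sphere_mul_szego hR1 hF hw
  have hfc := continuous_dilate hf hr
  have hHolder := integral_mul_norm_le_Lp_mul_Lq (μ := sphereMeasure n) hconj
    (f := fun ξ : sphere (0 : Cn n) 1 => f (r • (ξ : Cn n)))
    (g := fun ξ : sphere (0 : Cn n) 1 => ((‖kernelBase w (ξ : Cn n)‖ ^ (-(α + n)) : ℝ) : ℂ))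
    (hfc.memLp_of_hasCompactSupport (HasCompactSupport.of_compactSpace _))
    ((Complex.continuous_ofReal.comp
      (continuous_norm_kernelBase_rpow hw _)).memLp_of_hasCompactSupport
      (HasCompactSupport.of_compactSpace _))
  have hpow : ∀ ξ : sphere (0 : Cn n) 1,
      ‖((‖kernelBase w (ξ : Cn n)‖ ^ (-(α + n)) : ℝ) : ℂ)‖ ^ q' =
        ‖kernelBase w (ξ : Cn n)‖ ^ (-(2 * n) : ℝ) := by
    intro ξ
    rw [Complex.norm_real, Real.norm_eq_abs, abs_of_nonneg (by positivity),
      ← Real.rpow_mul (norm_nonneg _)]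
    congr 1
    have h1 : α + n = 2 * n * q'⁻¹ := by rw [hqq, hα]; field_simp; ring
    rw [h1]
    field_simp
  simp only [hpow] at hHolder
  rw [integral_norm_kernelBase hw, ← Real.rpow_mul ha0.le] at hHolder
  have hle : ‖f (r • w)‖ * a ^ (-α) ≤ (∫ ξ : sphere (0 : Cn n) 1, ‖f (r • (ξ : Cn n))‖ ^ q
      ∂sphereMeasure n) ^ (1 / q) * a ^ (-n * (1 / q') : ℝ) := by
    have h1 : ‖f (r • w)‖ * a ^ (-α) = ‖f (r • w) * kernelBase w w ^ (-α : ℂ)‖ := by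
      rw [norm_mul, kernelBase_self, ← Complex.ofReal_neg, Complex.norm_cpow_real,
        Complex.norm_real, Real.norm_eq_abs, abs_of_pos ha0]
    rw [h1, ← hrep]
    refine (norm_integral_le_integral_norm _).trans (le_of_eq_of_le ?_ hHolder)
    refine integral_congr_ae (Eventually.of_forall fun ξ => ?_)
    have hu : 0 < ‖kernelBase w (ξ : Cn n)‖ :=
      norm_pos_iff.2 (kernelBase_ne_zero (norm_mul_sphere_lt_one hw ξ))
    simp only
    rw [norm_mul, norm_mul, conj_kernelBase, ← Complex.ofReal_neg, Complex.norm_cpow_real,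
      norm_div, norm_one, norm_pow, RCLike.norm_conj, Complex.norm_real, Real.norm_eq_abs,
      abs_of_nonneg (by positivity), neg_add, Real.rpow_add hu, Real.rpow_neg hu.le (n : ℝ),
      Real.rpow_natCast, one_div, mul_assoc]
  have hexp : a ^ (-(n / q)) = a ^ α * a ^ (-n * (1 / q') : ℝ) := by
    rw [← Real.rpow_add ha0]
    congr 1
    rw [one_div, hqq, hα]
    field_simp
    ring
  calc ‖f (r • w)‖ = a ^ α * (‖f (r • w)‖ * a ^ (-α)) := by
        rw [Real.rpow_neg ha0.le]
        have := (Real.rpow_pos_of_pos ha0 α).ne'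
        field_simp
    _ ≤ a ^ α * ((∫ ξ : sphere (0 : Cn n) 1, ‖f (r • (ξ : Cn n))‖ ^ q
      ∂sphereMeasure n) ^ (1 / q) * a ^ (-n * (1 / q') : ℝ)) := by gcongr
    _ = _ := by rw [hexp]; ring

/-- The sharp growth estimate for functions in the Hardy space. -/
theorem HardySpace.norm_apply_le [Fact (1 ≤ p)] [NeZero n] (hp1 : 1 < p) (hp : p ≠ ∞)
    (f : HardySpace n p) {w : Cn n} (hw : ‖w‖ < 1) :
    ‖f.toFun w‖ ≤ (1 - ‖w‖ ^ 2) ^ (-(n / p.toReal)) * ‖f‖ := by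
  have hq : 1 < p.toReal := by
    rw [← ENNReal.toReal_one]; exact (ENNReal.toReal_lt_toReal (by simp) hp).2 hp1
  have hq0 : 0 < p.toReal := zero_lt_one.trans hq
  have hle : ∀ r ∈ Ioo (0 : ℝ) 1,
      ‖f.toFun (r • w)‖ ≤ (1 - ‖w‖ ^ 2) ^ (-(n / p.toReal)) * ‖f‖ := by
    intro r hr
    refine (norm_dilate_le_rpow_mul_integral hq f.mem_holomorphicBall hr hw).trans ?_
    have := one_sub_norm_sq_pos hw
    gcongr
    calc _ ≤ (‖f‖ ^ p.toReal) ^ (1 / p.toReal) := Real.rpow_le_rpow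
          (integral_nonneg fun _ => by positivity) (f.integral_rpow_le hp hr) (by positivity)
      _ = ‖f‖ := by rw [one_div, Real.rpow_rpow_inv (norm_nonneg _) hq0.ne']
  have hlim : Tendsto (fun r : ℝ => ‖f.toFun (r • w)‖) (𝓝[<] 1) (𝓝 ‖f.toFun w‖) := by
    have hc : ContinuousAt f.toFun ((1 : ℝ) • w) := by
      rw [one_smul]
      exact f.differentiableOn.continuousOn.continuousAt
        (isOpen_ball.mem_nhds (mem_ball_zero_iff.2 hw))
    have : ContinuousAt (fun r : ℝ => ‖f.toFun (r • w)‖) 1 :=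
      (ContinuousAt.comp (f := fun r : ℝ => r • w) hc (by fun_prop)).norm
    have h2 := this.tendsto
    rw [one_smul] at h2
    exact h2.mono_left nhdsWithin_le_nhds
  refine le_of_tendsto hlim ?_
  filter_upwards [Ioo_mem_nhdsLT (zero_lt_one' ℝ)] with r hr using hle r hr

/-! ### The normalized kernel functions -/

/-- The normalized kernel function `(1 - |w|²)^{n/p} (1 - ⟨z, w⟩)^{-2n/p}` on the ball. -/
def kernelFun (p : ℝ≥0∞) (w : Cn n) : Cn n → ℂ :=
  (ball (0 : Cn n) 1).indicator fun z =>
    (((1 - ‖w‖ ^ 2) ^ (n / p.toReal) : ℝ) : ℂ) *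
      kernelBase w z ^ ((-(2 * n / p.toReal) : ℝ) : ℂ)

theorem norm_kernelFun {w z : Cn n} (hw : ‖w‖ < 1) (hz : z ∈ ball (0 : Cn n) 1) :
    ‖kernelFun p w z‖ =
      (1 - ‖w‖ ^ 2) ^ (n / p.toReal) * ‖kernelBase w z‖ ^ (-(2 * n / p.toReal)) := by
  have ha0 := one_sub_norm_sq_pos hw
  rw [kernelFun, indicator_of_mem hz, norm_mul, Complex.norm_cpow_real, Complex.norm_real,
    Real.norm_eq_abs, abs_of_nonneg (by positivity)]

theorem norm_kernelFun_self {w : Cn n} (hw : ‖w‖ < 1) :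
    ‖kernelFun p w w‖ = (1 - ‖w‖ ^ 2) ^ (-(n / p.toReal)) := by
  have ha0 := one_sub_norm_sq_pos hw
  rw [norm_kernelFun hw (mem_ball_zero_iff.2 hw), kernelBase_self, Complex.norm_real,
    Real.norm_eq_abs, abs_of_pos ha0, ← Real.rpow_add ha0]
  congr 1
  ring

theorem norm_mul_lt_one_of_mem_unitBall {w z : Cn n} (hw : ‖w‖ < 1)
    (hz : z ∈ ball (0 : Cn n) 1) : ‖w‖ * ‖z‖ < 1 := by
  rw [mem_ball_zero_iff] at hz
  nlinarith [norm_nonneg w, norm_nonneg z]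

theorem kernelFun_mem_holomorphicBall {w : Cn n} (hw : ‖w‖ < 1) :
    kernelFun p w ∈ holomorphicBall n := by
  refine ⟨?_, fun z hz => indicator_of_notMem hz _⟩
  have : DifferentiableOn ℂ (fun z => (((1 - ‖w‖ ^ 2) ^ (n / p.toReal) : ℝ) : ℂ) *
      kernelBase w z ^ ((-(2 * n / p.toReal) : ℝ) : ℂ)) (ball (0 : Cn n) 1) :=
    (differentiableOn_kernelBase_cpow _
      fun z hz => norm_mul_lt_one_of_mem_unitBall hw hz).const_mul _
  exact this.congr fun z hz => indicator_of_mem hz _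

theorem smul_sphere_mem_ball {r : ℝ} (hr : r ∈ Ioo (0 : ℝ) 1) (ξ : sphere (0 : Cn n) 1) :
    r • (ξ : Cn n) ∈ ball (0 : Cn n) 1 := by
  rw [mem_ball_zero_iff, norm_smul, norm_eq_of_mem_sphere, mul_one, Real.norm_eq_abs,
    abs_of_pos hr.1]
  exact hr.2

/-- The mean of `|k_w|^p` over radius `r` is `((1 - |w|²) / (1 - |rw|²))^n ≤ 1`. -/
theorem hardyENorm_kernelFun_le [NeZero n] [Fact (1 ≤ p)] (hp : p ≠ ∞) {w : Cn n} (hw : ‖w‖ < 1) :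
    hardyENorm n p (kernelFun p w) ≤ ENNReal.ofReal 1 := by
  have hq := toReal_exponent_pos hp
  have ha0 := one_sub_norm_sq_pos hw
  refine hardyENorm_le_of_integral_le hp (kernelFun_mem_holomorphicBall hw) zero_le_one
    fun r hr => ?_
  have hrw : ‖r • w‖ ≤ ‖w‖ := by
    rw [norm_smul, Real.norm_eq_abs, abs_of_pos hr.1]
    exact mul_le_of_le_one_left (norm_nonneg _) hr.2.le
  have hrw' : ‖r • w‖ < 1 := hrw.trans_lt hw
  have h1 : ∀ ξ : sphere (0 : Cn n) 1, ‖kernelFun p w (r • (ξ : Cn n))‖ ^ p.toReal =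
      (1 - ‖w‖ ^ 2) ^ (n : ℝ) * ‖kernelBase (r • w) (ξ : Cn n)‖ ^ (-(2 * n) : ℝ) := by
    intro ξ
    rw [norm_kernelFun hw (smul_sphere_mem_ball hr ξ), kernelBase_smul,
      Real.mul_rpow (by positivity) (by positivity), ← Real.rpow_mul ha0.le,
      ← Real.rpow_mul (norm_nonneg _)]
    congr 2 <;> field_simp
  simp only [h1]
  have hb0 := one_sub_norm_sq_pos hrw'
  rw [integral_const_mul, integral_norm_kernelBase hrw', Real.one_rpow, Real.rpow_neg hb0.le,
    ← div_eq_mul_inv, div_le_one (by positivity)]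
  gcongr

end HardyNorm

/-! ### Uniform limits of holomorphic functions and completeness of `H^∞` -/

/-- A Schwarz estimate: `f` maps the ball into the closed ball of radius `2C` about `f c`, which is
where the factor 2 comes from. -/
theorem norm_fderiv_le_of_norm_le {E F : Type*} [NormedAddCommGroup E] [NormedSpace ℂ E]
    [NormedAddCommGroup F] [NormedSpace ℂ F] {f : E → F} {c : E} {R C : ℝ} (hR : 0 < R)
    (hf : DifferentiableOn ℂ f (ball c R)) (hC : ∀ z ∈ ball c R, ‖f z‖ ≤ C) :
    ‖fderiv ℂ f c‖ ≤ (2 * C) / R := by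
  refine Complex.norm_fderiv_le_div_of_mapsTo_ball hf (fun z hz => ?_) hR
  rw [mem_closedBall, dist_eq_norm, two_mul]
  exact (norm_sub_le _ _).trans (add_le_add (hC z hz) (hC c (mem_ball_self hR)))

/-- Weierstrass' theorem: the derivative estimate on half-size balls makes the derivatives uniformly
Cauchy, so the limit can be differentiated. -/
theorem differentiableOn_of_tendstoUniformlyOn_complex {E F : Type*} [NormedAddCommGroup E]
    [NormedSpace ℂ E] [NormedAddCommGroup F] [NormedSpace ℂ F] [CompleteSpace F]
    {f : ℕ → E → F} {g : E → F} {U : Set E} (hU : IsOpen U)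
    (hf : ∀ j, DifferentiableOn ℂ (f j) U) (hfg : TendstoUniformlyOn f g atTop U) :
    DifferentiableOn ℂ g U := by
  intro x hx
  obtain ⟨ρ, hρ, hρU⟩ := Metric.isOpen_iff.1 hU x hx
  have hsub : ∀ y ∈ ball x (ρ / 2), ball y (ρ / 2) ⊆ U := fun y hy =>
    (ball_subset_ball' (by rw [mem_ball] at hy; linarith)).trans hρU
  have hcauchy : UniformCauchySeqOn (fun j => fderiv ℂ (f j)) atTop (ball x (ρ / 2)) := by
    rw [Metric.uniformCauchySeqOn_iff]
    intro ε hε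
    have hc := hfg.uniformCauchySeqOn
    rw [Metric.uniformCauchySeqOn_iff] at hc
    -- On balls of radius `ρ / 2` the derivative bound becomes `2 (ερ/8) / (ρ/2) = ε/2`.
    obtain ⟨N, hN⟩ := hc (ε * ρ / 8) (by positivity)
    refine ⟨N, fun i hi j hj y hy => ?_⟩
    have hdy : ∀ j, DifferentiableAt ℂ (f j) y := fun j =>
      (hf j).differentiableAt (hU.mem_nhds (hsub y hy (mem_ball_self (by positivity))))
    rw [dist_eq_norm, ← fderiv_sub (hdy i) (hdy j)]
    refine (norm_fderiv_le_of_norm_le (half_pos hρ)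
      (((hf i).sub (hf j)).mono (hsub y hy)) (C := ε * ρ / 8) fun z hz => ?_).trans_lt ?_
    · have := hN i hi j hj z (hsub y hy hz)
      rw [dist_eq_norm] at this
      exact this.le
    · rw [div_lt_iff₀ (by positivity)]
      nlinarith
  have hlim : ∀ y ∈ ball x (ρ / 2), ∃ A, Tendsto (fun j => fderiv ℂ (f j) y) atTop (𝓝 A) :=
    fun y hy => cauchySeq_tendsto_of_complete (hcauchy.cauchySeq hy)
  choose! g' hg' using hlim
  have hunif := hcauchy.tendstoUniformlyOn_of_tendsto hg'
  have hxm : x ∈ ball x (ρ / 2) := mem_ball_self (by positivity)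
  have hmU : ball x (ρ / 2) ⊆ U := (ball_subset_ball (by linarith)).trans hρU
  exact (hasFDerivAt_of_tendstoUniformlyOn isOpen_ball hunif
    (fun j y hy => ((hf j).differentiableAt (hU.mem_nhds (hmU hy))).hasFDerivAt)
    (fun y hy => hfg.tendsto_at (hmU hy)) hxm).differentiableAt.differentiableWithinAt

/-- The norm is uniform, so a Cauchy sequence has a holomorphic uniform limit. Completeness makes
totally bounded images relatively compact. -/
instance HardySpace.completeSpace_top {n : ℕ} [NeZero n] : CompleteSpace (HardySpace n ∞) := by
  refine Metric.complete_of_cauchySeq_tendsto fun f hf => ?_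
  have hpt : ∀ z, CauchySeq fun j => (f j).toFun z := by
    intro z
    rw [Metric.cauchySeq_iff] at hf ⊢
    intro ε hε
    obtain ⟨N, hN⟩ := hf ε hε
    refine ⟨N, fun i hi j hj => ?_⟩
    have := hN i hi j hj
    rw [dist_eq_norm] at this ⊢
    exact (norm_apply_le_norm (f i - f j) z).trans_lt this
  choose g hg using fun z => cauchySeq_tendsto_of_complete (hpt z)
  have hunif : ∀ ε > 0, ∃ N, ∀ j ≥ N, ∀ z, ‖(f j).toFun z - g z‖ ≤ ε := by
    intro ε hε
    obtain ⟨N, hN⟩ := Metric.cauchySeq_iff.1 hf ε hε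
    refine ⟨N, fun j hj z => ?_⟩
    refine le_of_tendsto ((tendsto_const_nhds.sub (hg z)).norm) ?_
    filter_upwards [eventually_ge_atTop N] with i hi
    have := hN j hj i hi
    rw [dist_eq_norm] at this
    exact (norm_apply_le_norm (f j - f i) z).trans this.le
  have hTU : TendstoUniformlyOn (fun j => (f j).toFun) g atTop (ball 0 1) := by
    rw [Metric.tendstoUniformlyOn_iff]
    intro ε hε
    obtain ⟨N, hN⟩ := hunif (ε / 2) (half_pos hε)
    filter_upwards [eventually_ge_atTop N] with j hj z _
    rw [dist_comm, dist_eq_norm]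
    exact (hN j hj z).trans_lt (half_lt_self hε)
  have hgh : g ∈ holomorphicBall n := by
    refine ⟨differentiableOn_of_tendstoUniformlyOn_complex isOpen_ball
      (fun j => (f j).differentiableOn) hTU, fun z hz => ?_⟩
    refine tendsto_nhds_unique (hg z) ?_
    simp only [(f _).eq_zero_of_notMem hz]
    exact tendsto_const_nhds
  obtain ⟨N₁, hN₁⟩ := hunif 1 one_pos
  have hbd : hardyENorm n ∞ g < ∞ := by
    refine (hardyENorm_top_le (C := ‖f N₁‖ + 1) fun z _ => ?_).trans_lt ENNReal.ofReal_lt_top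
    have h1 := hN₁ N₁ le_rfl z
    have h2 := norm_apply_le_norm (f N₁) z
    have h3 := norm_sub_norm_le (g z) ((f N₁).toFun z)
    rw [norm_sub_rev] at h3
    linarith
  refine ⟨mk g hgh hbd, ?_⟩
  rw [Metric.tendsto_atTop]
  intro ε hε
  obtain ⟨N, hN⟩ := hunif (ε / 2) (half_pos hε)
  refine ⟨N, fun j hj => ?_⟩
  rw [dist_eq_norm]
  exact (norm_top_le (f := f j - mk g hgh hbd) (half_pos hε).le fun z _ => hN j hj z).trans_lt (half_lt_self hε)

/-! ### Compactness criteria -/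

/-- An operator into a complete space that is dominated by a compact operator is compact. -/
theorem isCompactOperator_of_norm_le {E F G : Type*} [NormedAddCommGroup E] [NormedSpace ℂ E]
    [NormedAddCommGroup F] [NormedSpace ℂ F] [CompleteSpace F] [NormedAddCommGroup G]
    [NormedSpace ℂ G] {T : E →L[ℂ] F} {S : E →L[ℂ] G} (hS : IsCompactOperator S) {M : ℝ}
    (hM : ∀ x, ‖T x‖ ≤ M * ‖S x‖) : IsCompactOperator T := by
  have htb : TotallyBounded (S '' closedBall 0 1) :=
    (IsCompactOperator.isCompact_closure_image_closedBall (f := (S : E →ₗ[ℂ] G)) hS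
      1).totallyBounded.subset subset_closure
  suffices h : TotallyBounded (T '' closedBall 0 1) by
    change IsCompactOperator (T : E →ₗ[ℂ] F)
    rw [isCompactOperator_iff_isCompact_closure_image_closedBall (T : E →ₗ[ℂ] F) zero_lt_one]
    exact h.closure.isCompact_of_isClosed isClosed_closure
  -- Replacing `M` by `|M| + 1` gives a strictly positive constant to divide by.
  have hM' : ∀ x, ‖T x‖ ≤ (|M| + 1) * ‖S x‖ := fun x => (hM x).trans (by
    gcongr; exact (le_abs_self M).trans (by linarith))
  rw [Metric.totallyBounded_iff]
  intro ε hε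
  obtain ⟨t, hts, htf, ht⟩ := htb.exists_subset (Metric.dist_mem_uniformity
    (show 0 < ε / (|M| + 1) by positivity))
  have := htf.to_subtype
  choose v _ hv using fun y : t => hts y.2
  refine ⟨range fun y => T (v y), Set.finite_range _, ?_⟩
  rintro _ ⟨x, hx, rfl⟩
  obtain ⟨y, hy, hxy⟩ := mem_iUnion₂.1 (ht ⟨x, hx, rfl⟩)
  refine mem_iUnion₂.2 ⟨T (v ⟨y, hy⟩), ⟨_, rfl⟩, ?_⟩
  have hxy' : ‖S x - S (v ⟨y, hy⟩)‖ < ε / (|M| + 1) := by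
    rw [hv, ← dist_eq_norm]; exact hxy
  rw [mem_ball, dist_eq_norm, ← map_sub]
  calc _ ≤ (|M| + 1) * ‖S (x - v ⟨y, hy⟩)‖ := hM' _
    _ < (|M| + 1) * (ε / (|M| + 1)) := by rw [map_sub]; gcongr
    _ = ε := mul_div_cancel₀ _ (by positivity)

theorem dilate_mem_holomorphicBall {n : ℕ} {f : Cn n → ℂ} (hf : f ∈ holomorphicBall n) {r : ℝ}
    (hr : r ∈ Ioo (0 : ℝ) 1) :
    ((ball (0 : Cn n) 1).indicator fun z => f (r • z)) ∈ holomorphicBall n := by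
  refine ⟨?_, fun z hz => indicator_of_notMem hz _⟩
  refine (hf.1.comp (differentiable_id.const_smul r).differentiableOn fun z hz => ?_).congr
    fun z hz => indicator_of_mem hz _
  rw [mem_ball_zero_iff] at hz
  simp only [id, Pi.smul_apply, mem_ball_zero_iff, norm_smul, Real.norm_eq_abs, abs_of_pos hr.1]
  nlinarith [hr.1, hr.2, norm_nonneg z]

/-! ### Restriction to smaller balls and dilation -/

namespace HardySpace

variable {n : ℕ} [NeZero n] {p : ℝ≥0∞} [Fact (1 ≤ p)]

/-- Uniform bound on compact balls. -/
theorem exists_norm_apply_le (hp1 : 1 < p) (hp : p ≠ ∞) {ρ : ℝ} (hρ : ρ < 1) :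
    ∃ M : ℝ, 0 ≤ M ∧ ∀ (f : HardySpace n p), ∀ z ∈ closedBall (0 : Cn n) ρ,
      ‖f.toFun z‖ ≤ M * ‖f‖ := by
  by_cases hρ0 : 0 ≤ ρ
  · have h0 : 0 < 1 - ρ ^ 2 := by nlinarith
    refine ⟨(1 - ρ ^ 2) ^ (-(n / p.toReal)), Real.rpow_nonneg h0.le _, fun f z hz => ?_⟩
    rw [mem_closedBall_zero_iff] at hz
    refine (f.norm_apply_le hp1 hp (hz.trans_lt hρ)).trans ?_
    refine mul_le_mul_of_nonneg_right ?_ (norm_nonneg _)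
    exact Real.rpow_le_rpow_of_nonpos h0 (by gcongr) (neg_nonpos.2
      (div_nonneg n.cast_nonneg ENNReal.toReal_nonneg))
  · refine ⟨0, le_rfl, fun f z hz => ?_⟩
    rw [closedBall_eq_empty.2 (not_le.1 hρ0)] at hz
    exact hz.elim

/-- Uniform Lipschitz estimate on compact balls. -/
theorem exists_norm_sub_apply_le (hp1 : 1 < p) (hp : p ≠ ∞) {ρ : ℝ} (hρ : ρ < 1) :
    ∃ K : ℝ, 0 ≤ K ∧ ∀ (f : HardySpace n p), ∀ z ∈ closedBall (0 : Cn n) ρ,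
      ∀ w ∈ closedBall (0 : Cn n) ρ, ‖f.toFun z - f.toFun w‖ ≤ K * ‖f‖ * ‖z - w‖ := by
  set d := (1 - ρ) / 2 with hd
  have hd0 : 0 < d := by linarith
  obtain ⟨M, hM0, hM⟩ := exists_norm_apply_le (n := n) hp1 hp (show (1 + ρ) / 2 < 1 by linarith)
  refine ⟨2 * M / d, by positivity, fun f z hz w hw => ?_⟩
  have hbound : ∀ x ∈ ball w d, ‖f.toFun x - f.toFun w‖ ≤ 2 * M * ‖f‖ := by
    intro x hx
    have h1 : x ∈ closedBall (0 : Cn n) ((1 + ρ) / 2) := by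
      rw [mem_closedBall_zero_iff] at hw ⊢
      rw [mem_ball, dist_eq_norm] at hx
      have := norm_sub_norm_le x w
      linarith
    have h2 : w ∈ closedBall (0 : Cn n) ((1 + ρ) / 2) := closedBall_subset_closedBall (by linarith) hw
    have := norm_sub_le (f.toFun x) (f.toFun w)
    linarith [hM f x h1, hM f w h2]
  -- Close points are handled by the Schwarz lemma on `ball w d`. For distant points `‖z - w‖ / d ≥
  -- 1`, so the sup bound already suffices.
  by_cases hzw : z ∈ ball w d
  · have hsub : ball w d ⊆ ball (0 : Cn n) 1 := by
      refine ball_subset_ball' ?_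
      rw [mem_closedBall] at hw
      linarith
    have := Complex.dist_le_div_mul_dist_of_mapsTo_ball (f.differentiableOn.mono hsub)
      (R₂ := 2 * M * ‖f‖) (fun x hx => by
        rw [mem_closedBall, dist_eq_norm]; exact hbound x hx) hzw
    rw [dist_eq_norm, dist_eq_norm] at this
    calc _ ≤ _ := this
      _ = _ := by ring
  · rw [mem_ball, not_lt, dist_eq_norm] at hzw
    have hmono : closedBall (0 : Cn n) ρ ⊆ closedBall 0 ((1 + ρ) / 2) :=
      closedBall_subset_closedBall (by linarith)
    have h1 := hM f z (hmono hz)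
    have h2 := hM f w (hmono hw)
    have h3 := norm_sub_le (f.toFun z) (f.toFun w)
    have h4 : 2 * M * ‖f‖ * 1 ≤ 2 * M * ‖f‖ * (‖z - w‖ / d) := by
      gcongr
      rwa [one_le_div hd0]
    calc _ ≤ 2 * M * ‖f‖ * 1 := by linarith
      _ ≤ _ := h4
      _ = _ := by ring

/-- Restriction of Hardy space functions to a compact ball. -/
def restrict (hp1 : 1 < p) (hp : p ≠ ∞) {ρ : ℝ} (hρ : ρ < 1) :
    HardySpace n p →L[ℂ] BoundedContinuousFunction (closedBall (0 : Cn n) ρ) ℂ :=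
  have hc (f : HardySpace n p) : Continuous fun z : closedBall (0 : Cn n) ρ => f.toFun z :=
    f.differentiableOn.continuousOn.comp_continuous continuous_subtype_val
      fun z => closedBall_subset_ball hρ z.2
  LinearMap.mkContinuousOfExistsBound
    { toFun := fun f => BoundedContinuousFunction.mkOfCompact ⟨_, hc f⟩
      map_add' := fun f g => by ext z; rfl
      map_smul' := fun c f => by ext z; rfl }
    (by
      obtain ⟨M, hM0, hM⟩ := exists_norm_apply_le (n := n) hp1 hp hρ
      exact ⟨M, fun f => (BoundedContinuousFunction.norm_le (by positivity)).2
        fun z => hM f z z.2⟩)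

/-- Montel's theorem in operator form: the unit ball is uniformly bounded and has a common Lipschitz
constant on the smaller ball, so Arzelà–Ascoli applies. -/
theorem isCompactOperator_restrict (hp1 : 1 < p) (hp : p ≠ ∞) {ρ : ℝ} (hρ : ρ < 1) :
    IsCompactOperator (restrict (n := n) hp1 hp hρ) := by
  obtain ⟨M, hM0, hM⟩ := exists_norm_apply_le (n := n) hp1 hp hρ
  obtain ⟨K, hK0, hK⟩ := exists_norm_sub_apply_le (n := n) hp1 hp hρ
  change IsCompactOperator (restrict (n := n) hp1 hp hρ :
    HardySpace n p →ₗ[ℂ] BoundedContinuousFunction (closedBall (0 : Cn n) ρ) ℂ)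
  rw [isCompactOperator_iff_isCompact_closure_image_closedBall _ zero_lt_one]
  refine BoundedContinuousFunction.arzela_ascoli (closedBall 0 M) (isCompact_closedBall _ _) _ ?_ ?_
  · rintro _ z ⟨f, hf, rfl⟩
    rw [mem_closedBall_zero_iff] at hf ⊢
    exact (hM f z z.2).trans (mul_le_of_le_one_right hM0 hf)
  · refine Metric.equicontinuous_of_continuity_modulus (fun x => K * x) ?_ _ ?_
    · have : Continuous fun x : ℝ => K * x := by fun_prop
      simpa using this.tendsto 0
    · rintro z w ⟨_, f, hf, rfl⟩
      rw [mem_closedBall_zero_iff] at hf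
      rw [dist_eq_norm, Subtype.dist_eq, dist_eq_norm]
      refine (hK f z z.2 w w.2).trans ?_
      gcongr
      exact mul_le_of_le_one_right hK0 hf

theorem hardyENorm_dilate_le (hp : p ≠ ∞) (f : HardySpace n p) {r : ℝ} (hr : r ∈ Ioo (0 : ℝ) 1) :
    hardyENorm n p ((ball (0 : Cn n) 1).indicator fun z => f.toFun (r • z)) ≤
      ENNReal.ofReal ‖f‖ := by
  refine hardyENorm_le_of_integral_le hp (dilate_mem_holomorphicBall f.mem_holomorphicBall hr)
    (norm_nonneg _) fun s hs => ?_
  have h1 : ∀ ξ : sphere (0 : Cn n) 1,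
      ((ball (0 : Cn n) 1).indicator fun z => f.toFun (r • z)) (s • (ξ : Cn n)) =
        f.toFun ((r * s) • (ξ : Cn n)) := by
    intro ξ
    rw [indicator_of_mem (smul_sphere_mem_ball hs ξ), smul_smul]
  simp only [h1]
  exact f.integral_rpow_le hp ⟨mul_pos hr.1 hs.1, by nlinarith [hr.1, hr.2, hs.1, hs.2]⟩

/-- The dilation operator `f ↦ f(r ·)`. -/
def dilation (hp : p ≠ ∞) {r : ℝ} (hr : r ∈ Ioo (0 : ℝ) 1) :
    HardySpace n p →L[ℂ] HardySpace n p :=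
  LinearMap.mkContinuous
    { toFun := fun f => mk _ (dilate_mem_holomorphicBall f.mem_holomorphicBall hr)
        ((hardyENorm_dilate_le hp f hr).trans_lt ENNReal.ofReal_lt_top)
      map_add' := fun f g => by
        refine HardySpace.ext (funext fun z => ?_)
        by_cases hz : z ∈ ball (0 : Cn n) 1 <;> simp [hz]
      map_smul' := fun c f => by
        refine HardySpace.ext (funext fun z => ?_)
        by_cases hz : z ∈ ball (0 : Cn n) 1 <;> simp [hz] } 1
    (fun f => by
      rw [one_mul]
      exact norm_le_of_hardyENorm_le (norm_nonneg _) (hardyENorm_dilate_le hp f hr))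

theorem dilation_apply (hp : p ≠ ∞) {r : ℝ} (hr : r ∈ Ioo (0 : ℝ) 1) (f : HardySpace n p)
    {z : Cn n} (hz : z ∈ ball (0 : Cn n) 1) : (dilation hp hr f).toFun z = f.toFun (r • z) :=
  indicator_of_mem hz fun z => f.toFun (r • z)

theorem norm_dilation_apply_le (hp : p ≠ ∞) {r : ℝ} (hr : r ∈ Ioo (0 : ℝ) 1)
    (f : HardySpace n p) : ‖dilation hp hr f‖ ≤ ‖f‖ :=
  norm_le_of_hardyENorm_le (norm_nonneg _) (hardyENorm_dilate_le hp f hr)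

end HardySpace

/-! ### Concentration of the normalized kernel functions -/

section Concentration

variable {n : ℕ} {p : ℝ≥0∞}

/-- Write `1 - s = (1 - rs) - (1 - r)s` and use `(1 - r)|s| ≤ 1 - r|s| ≤ |1 - rs|`. The bound is
uniform in `r`, so one function on the sphere controls every dilate. -/
theorem norm_kernelBase_le_two_mul {w : Cn n} (hw : ‖w‖ ≤ 1) {r : ℝ} (hr : r ∈ Ioo (0 : ℝ) 1)
    (ξ : sphere (0 : Cn n) 1) :
    ‖kernelBase w (ξ : Cn n)‖ ≤ 2 * ‖kernelBase w (r • (ξ : Cn n))‖ := by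
  set s := inner ℂ w (ξ : Cn n) with hs
  have hs1 : ‖s‖ ≤ 1 := (norm_inner_le_norm _ _).trans (by simpa using hw)
  have h1 : kernelBase w (r • (ξ : Cn n)) = 1 - r * s := by
    rw [kernelBase, ← Complex.coe_smul, inner_smul_right]
  have h2 : kernelBase w (ξ : Cn n) = (1 - r * s) - (1 - r : ℝ) * s := by
    rw [kernelBase]; push_cast; ring
  have h3 : ‖((1 - r : ℝ) : ℂ) * s‖ = (1 - r) * ‖s‖ := by
    rw [norm_mul, Complex.norm_real, Real.norm_eq_abs, abs_of_pos (by linarith [hr.2])]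
  have h4 : 1 - r * ‖s‖ ≤ ‖1 - r * s‖ := by
    have := norm_sub_norm_le (1 : ℂ) (r * s)
    rwa [norm_one, norm_mul, Complex.norm_real, Real.norm_eq_abs, abs_of_pos hr.1] at this
  rw [h1, h2]
  have h5 := norm_sub_le (1 - r * s) (((1 - r : ℝ) : ℂ) * s)
  rw [h3] at h5
  nlinarith

/-- A majorant on the sphere of all dilates of the normalized kernel function. -/
def kernelMajorant (p : ℝ≥0∞) (w : Cn n) (ξ : sphere (0 : Cn n) 1) : ℝ :=
  (1 - ‖w‖ ^ 2) ^ (n / p.toReal) * (‖kernelBase w (ξ : Cn n)‖ / 2) ^ (-(2 * n / p.toReal))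

theorem norm_kernelFun_smul_le_majorant {w : Cn n} (hw : ‖w‖ < 1) {r : ℝ}
    (hr : r ∈ Ioo (0 : ℝ) 1) (ξ : sphere (0 : Cn n) 1) :
    ‖kernelFun p w (r • (ξ : Cn n))‖ ≤ kernelMajorant p w ξ := by
  have ha0 := one_sub_norm_sq_pos hw
  rw [norm_kernelFun hw (smul_sphere_mem_ball hr ξ), kernelMajorant]
  have h1 : 0 < ‖kernelBase w (ξ : Cn n)‖ :=
    norm_pos_iff.2 (kernelBase_ne_zero (norm_mul_sphere_lt_one hw ξ))
  have h2 := norm_kernelBase_le_two_mul hw.le hr ξ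
  have h3 : -(2 * n / p.toReal) ≤ 0 := by
    have : 0 ≤ 2 * n / p.toReal := div_nonneg (by positivity) ENNReal.toReal_nonneg
    linarith
  gcongr ?_ * ?_
  exact Real.rpow_le_rpow_of_nonpos (by positivity) (by linarith) h3

/-- Equality case of Cauchy–Schwarz: unit vectors with inner product one coincide. -/
theorem kernelBase_sphere_ne_zero {ζ : Cn n} (hζ : ‖ζ‖ = 1) {ξ : sphere (0 : Cn n) 1}
    (h : (ξ : Cn n) ≠ ζ) : kernelBase ζ (ξ : Cn n) ≠ 0 := by
  rw [kernelBase, sub_ne_zero]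
  intro h1
  exact h ((inner_eq_one_iff_of_norm_eq_one hζ (norm_eq_of_mem_sphere ξ)).1 h1.symm).symm

theorem tendsto_kernelMajorant [NeZero n] [Fact (1 ≤ p)] (hp : p ≠ ∞) {w : ℕ → Cn n} {ζ : Cn n}
    (hw : Tendsto w atTop (𝓝 ζ)) (hζ : ‖ζ‖ = 1) {ξ : sphere (0 : Cn n) 1} (h : (ξ : Cn n) ≠ ζ) :
    Tendsto (fun j => kernelMajorant p (w j) ξ) atTop (𝓝 0) := by
  have hq := toReal_exponent_pos hp
  have hn : 0 < (n : ℝ) := by exact_mod_cast NeZero.pos n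
  have h1 : Tendsto (fun j => (1 - ‖w j‖ ^ 2) ^ (n / p.toReal)) atTop (𝓝 0) := by
    have h2 : Tendsto (fun j => 1 - ‖w j‖ ^ 2) atTop (𝓝 0) := by
      have := (hw.norm.pow 2).const_sub 1
      rwa [hζ, one_pow, sub_self] at this
    have := h2.rpow_const (p := n / p.toReal) (Or.inr (by positivity))
    rwa [Real.zero_rpow (by positivity)] at this
  have h2 : Tendsto (fun j => (‖kernelBase (w j) (ξ : Cn n)‖ / 2) ^ (-(2 * n / p.toReal))) atTop
      (𝓝 ((‖kernelBase ζ (ξ : Cn n)‖ / 2) ^ (-(2 * n / p.toReal)))) := by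
    refine Tendsto.rpow_const (Tendsto.div_const ?_ _) (Or.inl ?_)
    · have : Continuous fun w : Cn n => ‖kernelBase w (ξ : Cn n)‖ := by
        simp only [kernelBase]; fun_prop
      exact (this.tendsto ζ).comp hw
    · have := norm_pos_iff.2 (kernelBase_sphere_ne_zero hζ h)
      positivity
  simpa [kernelMajorant] using h1.mul h2

theorem continuous_kernelMajorant {w : Cn n} (hw : ‖w‖ < 1) : Continuous (kernelMajorant p w) := by
  refine continuous_const.mul (Continuous.rpow_const ?_ fun ξ => Or.inl ?_)
  · exact ((differentiable_kernelBase.continuous.comp continuous_subtype_val).norm).div_const _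
  · have := norm_pos_iff.2 (kernelBase_ne_zero (norm_mul_sphere_lt_one hw ξ))
    positivity

theorem kernelMajorant_nonneg {w : Cn n} (hw : ‖w‖ < 1) (ξ : sphere (0 : Cn n) 1) :
    0 ≤ kernelMajorant p w ξ := by
  have := one_sub_norm_sq_pos hw
  rw [kernelMajorant]; positivity

/-- The majorants tend to zero off the single null point `ζ`, and almost everywhere convergence on a
finite measure space gives convergence in measure. -/
theorem tendsto_measure_kernelMajorant_ge [NeZero n] [Fact (1 ≤ p)] (hp : p ≠ ∞) {w : ℕ → Cn n}
    {ζ : Cn n} (hw1 : ∀ j, ‖w j‖ < 1) (hw : Tendsto w atTop (𝓝 ζ)) (hζ : ‖ζ‖ = 1) {δ : ℝ}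
    (hδ : 0 < δ) :
    Tendsto (fun j => sphereMeasure n {ξ | δ ≤ kernelMajorant p (w j) ξ}) atTop (𝓝 0) := by
  have hae : ∀ᵐ ξ ∂sphereMeasure n,
      Tendsto (fun j => kernelMajorant p (w j) ξ) atTop (𝓝 0) := by
    have h0 : sphereMeasure n {⟨ζ, mem_sphere_zero_iff_norm.2 hζ⟩} = 0 := sphereMeasure_singleton _
    filter_upwards [compl_mem_ae_iff.2 h0] with ξ hξ
    exact tendsto_kernelMajorant hp hw hζ fun h => hξ (Subtype.ext h)
  have := tendstoInMeasure_iff_norm.1 (tendstoInMeasure_of_tendsto_ae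
    (fun j => (continuous_kernelMajorant (hw1 j)).aestronglyMeasurable) hae) δ hδ
  simpa [abs_of_nonneg (kernelMajorant_nonneg (hw1 _) _)] using this

end Concentration

/-! ### Compact operators on concentrating kernels -/

namespace HardySpace

variable {n : ℕ} [NeZero n] {p : ℝ≥0∞} [Fact (1 ≤ p)]

/-- The normalized kernel function as an element of the Hardy space. -/
def kernel (hp : p ≠ ∞) {w : Cn n} (hw : ‖w‖ < 1) : HardySpace n p :=
  mk (kernelFun p w) (kernelFun_mem_holomorphicBall hw)
    ((hardyENorm_kernelFun_le hp hw).trans_lt ENNReal.ofReal_lt_top)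

theorem toFun_kernel (hp : p ≠ ∞) {w : Cn n} (hw : ‖w‖ < 1) :
    (kernel hp hw).toFun = kernelFun p w := rfl

theorem norm_kernel_le (hp : p ≠ ∞) {w : Cn n} (hw : ‖w‖ < 1) : ‖kernel hp hw‖ ≤ 1 :=
  norm_le_of_hardyENorm_le zero_le_one (hardyENorm_kernelFun_le hp hw)

/-- Each kernel is bounded, so finite sums of kernels stay bounded and a further concentrated kernel
can be added. -/
theorem exists_norm_kernel_apply_le (hp : p ≠ ∞) {w : Cn n} (hw : ‖w‖ < 1) :
    ∃ M, ∀ z ∈ ball (0 : Cn n) 1, ‖(kernel hp hw).toFun z‖ ≤ M := by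
  have ha0 := one_sub_norm_sq_pos hw
  refine ⟨(1 - ‖w‖ ^ 2) ^ (n / p.toReal) * (1 - ‖w‖) ^ (-(2 * n / p.toReal)), fun z hz => ?_⟩
  rw [toFun_kernel, norm_kernelFun hw hz]
  have h3 : -(2 * n / p.toReal) ≤ 0 := by
    have : 0 ≤ 2 * n / p.toReal := div_nonneg (by positivity) ENNReal.toReal_nonneg
    linarith
  gcongr ?_ * ?_
  refine Real.rpow_le_rpow_of_nonpos (by linarith) ?_ h3
  have h4 := norm_sub_norm_le (1 : ℂ) (inner ℂ w z)
  have h5 := norm_inner_le_norm (𝕜 := ℂ) w z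
  rw [mem_ball_zero_iff] at hz
  rw [norm_one] at h4
  rw [kernelBase]
  nlinarith [norm_nonneg w]

/-- Adding a highly concentrated kernel function to a bounded function is almost a disjoint sum. -/
theorem eventually_norm_add_kernel_le (hp : p ≠ ∞) {w : ℕ → Cn n} {ζ : Cn n}
    (hw1 : ∀ j, ‖w j‖ < 1) (hw : Tendsto w atTop (𝓝 ζ)) (hζ : ‖ζ‖ = 1) (F : HardySpace n p)
    {M : ℝ} (hM : ∀ z ∈ ball (0 : Cn n) 1, ‖F.toFun z‖ ≤ M) {ε : ℝ} (hε : 0 < ε) :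
    ∀ᶠ j in atTop, ‖F + kernel hp (hw1 j)‖ ≤ (‖F‖ ^ p.toReal + 1) ^ p.toReal⁻¹ + ε := by
  have hq := toReal_exponent_pos hp
  have hM0 : 0 ≤ M := (norm_nonneg _).trans (hM 0 (mem_ball_self one_pos))
  -- This is the `L^p` norm of the constant `M` on the set where the majorant is at least `ε / 2`.
  -- That set does not involve `r`, so a single `j` serves all radii.
  have hlim : Tendsto (fun j => ENNReal.ofReal M *
      sphereMeasure n {ξ | ε / 2 ≤ kernelMajorant p (w j) ξ} ^ (1 / p.toReal)) atTop (𝓝 0) := by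
    have h1 := (tendsto_measure_kernelMajorant_ge hp hw1 hw hζ (half_pos hε)).ennrpow_const
      (1 / p.toReal)
    rw [ENNReal.zero_rpow_of_pos (by positivity)] at h1
    simpa using ENNReal.Tendsto.const_mul h1 (Or.inr (ENNReal.ofReal_ne_top (r := M)))
  filter_upwards [hlim.eventually_le_const (ENNReal.ofReal_pos.2 (half_pos hε))] with j hj
  set k := kernel hp (hw1 j) with hk
  set B := {ξ : sphere (0 : Cn n) 1 | ε / 2 ≤ kernelMajorant p (w j) ξ} with hB
  have hBm : MeasurableSet B :=
    (isClosed_le continuous_const (continuous_kernelMajorant (hw1 j))).measurableSet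
  refine norm_le_of_hardyENorm_le (by positivity) ?_
  rw [hardyENorm, if_neg hp]
  refine iSup₂_le fun r hr => ?_
  have hFc := continuous_dilate F.mem_holomorphicBall hr
  have hkc := continuous_dilate k.mem_holomorphicBall hr
  set g₁ : sphere (0 : Cn n) 1 → ℝ := fun ξ =>
    (‖F.toFun (r • (ξ : Cn n))‖ ^ p.toReal + ‖k.toFun (r • (ξ : Cn n))‖ ^ p.toReal) ^ p.toReal⁻¹
    with hg₁
  have hg₁c : Continuous g₁ := by
    have h1 : Continuous fun ξ : sphere (0 : Cn n) 1 => ‖F.toFun (r • (ξ : Cn n))‖ ^ p.toReal :=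
      hFc.norm.rpow_const fun _ => Or.inr hq.le
    have h2 : Continuous fun ξ : sphere (0 : Cn n) 1 => ‖k.toFun (r • (ξ : Cn n))‖ ^ p.toReal :=
      hkc.norm.rpow_const fun _ => Or.inr hq.le
    exact (h1.add h2).rpow_const fun _ => Or.inr (by positivity)
  -- The function `g₁` dominates each summand separately. On `B` the kernel goes into `g₁` and `F`
  -- into `M`; off `B` it is `F` that goes into `g₁`, and the kernel is below `ε / 2`.
  have hpt : ∀ ξ : sphere (0 : Cn n) 1, ‖(F + k).toFun (r • (ξ : Cn n))‖ ≤
      g₁ ξ + (B.indicator (fun _ => M) ξ + ε / 2) := by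
    intro ξ
    have hF1 : ‖F.toFun (r • (ξ : Cn n))‖ ≤ g₁ ξ := by
      conv_lhs => rw [← Real.rpow_rpow_inv (norm_nonneg (F.toFun (r • (ξ : Cn n)))) hq.ne']
      exact Real.rpow_le_rpow (by positivity) (le_add_of_nonneg_right (by positivity))
        (by positivity)
    have hk1 : ‖k.toFun (r • (ξ : Cn n))‖ ≤ g₁ ξ := by
      conv_lhs => rw [← Real.rpow_rpow_inv (norm_nonneg (k.toFun (r • (ξ : Cn n)))) hq.ne']
      exact Real.rpow_le_rpow (by positivity) (le_add_of_nonneg_left (by positivity))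
        (by positivity)
    have hadd := norm_add_le (F.toFun (r • (ξ : Cn n))) (k.toFun (r • (ξ : Cn n)))
    rw [toFun_add]
    by_cases hξ : ξ ∈ B
    · rw [indicator_of_mem hξ]
      have := hM _ (smul_sphere_mem_ball hr ξ)
      linarith
    · rw [indicator_of_notMem hξ]
      have h1 : ‖k.toFun (r • (ξ : Cn n))‖ ≤ kernelMajorant p (w j) ξ :=
        norm_kernelFun_smul_le_majorant (hw1 j) hr ξ
      have h2 : kernelMajorant p (w j) ξ < ε / 2 := not_le.1 hξ
      linarith
  have hp1 : 1 ≤ p := Fact.out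
  have hp0 : p ≠ 0 := (zero_lt_one.trans_le hp1).ne'
  have hind : AEStronglyMeasurable (B.indicator fun _ => M) (sphereMeasure n) :=
    aestronglyMeasurable_const.indicator hBm
  have he₁ : eLpNorm g₁ p (sphereMeasure n) ≤
      ENNReal.ofReal ((‖F‖ ^ p.toReal + 1) ^ p.toReal⁻¹) := by
    rw [eLpNorm_sphere_eq hp hg₁c]
    refine ENNReal.ofReal_le_ofReal (Real.rpow_le_rpow
      (integral_nonneg fun _ => by positivity) ?_ (by positivity))
    have h1 : ∀ ξ, ‖g₁ ξ‖ ^ p.toReal = ‖F.toFun (r • (ξ : Cn n))‖ ^ p.toReal +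
        ‖k.toFun (r • (ξ : Cn n))‖ ^ p.toReal := by
      intro ξ
      rw [Real.norm_eq_abs, abs_of_nonneg (by positivity), hg₁,
        Real.rpow_inv_rpow (by positivity) hq.ne']
    simp only [h1]
    rw [integral_add
      (integrable_sphere_of_continuous (hFc.norm.rpow_const fun _ => Or.inr hq.le))
      (integrable_sphere_of_continuous (hkc.norm.rpow_const fun _ => Or.inr hq.le))]
    refine add_le_add (F.integral_rpow_le hp hr) ((k.integral_rpow_le hp hr).trans ?_)
    exact Real.rpow_le_one (norm_nonneg _) (norm_kernel_le hp (hw1 j)) hq.le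
  calc _ ≤ eLpNorm (g₁ + (B.indicator (fun _ => M) + fun _ => ε / 2)) p (sphereMeasure n) :=
        eLpNorm_mono_real hpt
    _ ≤ eLpNorm g₁ p (sphereMeasure n) + (eLpNorm (B.indicator fun _ => M) p (sphereMeasure n) +
        eLpNorm (fun _ : sphere (0 : Cn n) 1 => ε / 2) p (sphereMeasure n)) :=
        (eLpNorm_add_le hg₁c.aestronglyMeasurable (hind.add aestronglyMeasurable_const) hp1).trans
          (add_le_add le_rfl (eLpNorm_add_le hind aestronglyMeasurable_const hp1))
    _ ≤ ENNReal.ofReal ((‖F‖ ^ p.toReal + 1) ^ p.toReal⁻¹) +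
        (ENNReal.ofReal (ε / 2) + ENNReal.ofReal (ε / 2)) := by
        refine add_le_add he₁ (add_le_add ?_ ?_)
        · rw [eLpNorm_indicator_const hBm hp0 hp, Real.enorm_eq_ofReal hM0]
          exact hj
        · rw [eLpNorm_const' _ hp0 hp, measure_univ, ENNReal.one_rpow, mul_one,
            Real.enorm_eq_ofReal (half_pos hε).le]
    _ = _ := by
        rw [← ENNReal.ofReal_add (by positivity) (by positivity), add_halves,
          ← ENNReal.ofReal_add (by positivity) hε.le]

/-- Enlarging `1` to `2` absorbs the error `ε`, giving a recursion for `‖F‖^p` that can be iterated.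
-/
theorem eventually_norm_add_kernel_rpow_le (hp : p ≠ ∞) {w : ℕ → Cn n} {ζ : Cn n}
    (hw1 : ∀ j, ‖w j‖ < 1) (hw : Tendsto w atTop (𝓝 ζ)) (hζ : ‖ζ‖ = 1) (F : HardySpace n p)
    {M : ℝ} (hM : ∀ z ∈ ball (0 : Cn n) 1, ‖F.toFun z‖ ≤ M) :
    ∀ᶠ j in atTop, ‖F + kernel hp (hw1 j)‖ ^ p.toReal ≤ ‖F‖ ^ p.toReal + 2 := by
  have hq := toReal_exponent_pos hp
  have hF0 : 0 ≤ ‖F‖ ^ p.toReal := by positivity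
  have hlt : (‖F‖ ^ p.toReal + 1) ^ p.toReal⁻¹ < (‖F‖ ^ p.toReal + 2) ^ p.toReal⁻¹ :=
    Real.rpow_lt_rpow (by positivity) (by linarith) (by positivity)
  filter_upwards [eventually_norm_add_kernel_le hp hw1 hw hζ F hM (sub_pos.2 hlt)] with j hj
  rw [add_sub_cancel] at hj
  calc _ ≤ ((‖F‖ ^ p.toReal + 2) ^ p.toReal⁻¹) ^ p.toReal := by gcongr
    _ = _ := Real.rpow_inv_rpow (by positivity) hq.ne'

/-- Gliding hump: add `N` kernels, each concentrated enough relative to the previous sum. The norm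
grows at most like `N^{1/p}`, while the image grows linearly in `N` if `g ≠ 0`; this is where `p >
1` enters. -/
theorem eq_zero_of_tendsto_map_kernel {V : Type*} [NormedAddCommGroup V] [NormedSpace ℂ V]
    (hp1 : 1 < p) (hp : p ≠ ∞) {w : ℕ → Cn n} {ζ : Cn n}
    (hw1 : ∀ j, ‖w j‖ < 1) (hw : Tendsto w atTop (𝓝 ζ)) (hζ : ‖ζ‖ = 1)
    (K : HardySpace n p →L[ℂ] V) {g : V}
    (hg : Tendsto (fun j => K (kernel hp (hw1 j))) atTop (𝓝 g)) : g = 0 := by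
  by_contra hg0
  have hgpos : 0 < ‖g‖ := norm_pos_iff.2 hg0
  have hq : 1 < p.toReal := by
    rw [← ENNReal.toReal_one]; exact (ENNReal.toReal_lt_toReal (by simp) hp).2 hp1
  have hq0 : 0 < p.toReal := zero_lt_one.trans hq
  have hind : ∀ N : ℕ, ∃ (F : HardySpace n p) (M : ℝ), (∀ z ∈ ball (0 : Cn n) 1, ‖F.toFun z‖ ≤ M) ∧
      ‖F‖ ^ p.toReal ≤ 2 * N ∧ ‖K F - (N : ℂ) • g‖ ≤ N * (‖g‖ / 2) := by
    intro N
    induction N with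
    | zero =>
      refine ⟨0, 0, fun z _ => ?_, ?_, by simp⟩
      · change ‖(0 : ℂ)‖ ≤ 0
        simp
      · simp [hq0.ne']
    | succ N ih =>
      obtain ⟨F, M, hM, hF, hK⟩ := ih
      have h1 := eventually_norm_add_kernel_rpow_le hp hw1 hw hζ F hM
      have h2 : ∀ᶠ j in atTop, ‖K (kernel hp (hw1 j)) - g‖ < ‖g‖ / 2 := by
        have := Metric.tendsto_nhds.1 hg (‖g‖ / 2) (by positivity)
        simpa only [dist_eq_norm] using this
      obtain ⟨j, hj1, hj2⟩ := (h1.and h2).exists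
      obtain ⟨M', hM'⟩ := exists_norm_kernel_apply_le hp (hw1 j)
      refine ⟨F + kernel hp (hw1 j), M + M', fun z hz => ?_, ?_, ?_⟩
      · exact (norm_add_le _ _).trans (add_le_add (hM z hz) (hM' z hz))
      · push_cast; linarith
      · have : K (F + kernel hp (hw1 j)) - ((N + 1 : ℕ) : ℂ) • g =
            (K F - (N : ℂ) • g) + (K (kernel hp (hw1 j)) - g) := by
          rw [map_add]; push_cast; module
        rw [this]
        refine (norm_add_le _ _).trans ?_
        push_cast; linarith
  -- This constant comes from `(N‖g‖/2)^p ≤ ‖K‖^p · 2N` after division by `N`.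
  set C : ℝ := ‖K‖ ^ p.toReal * 2 / (‖g‖ / 2) ^ p.toReal with hC
  have hbound : ∀ N : ℕ, 0 < N → (N : ℝ) ^ (p.toReal - 1) ≤ C := by
    intro N hN
    have hN' : (0 : ℝ) < N := by exact_mod_cast hN
    obtain ⟨F, M, -, hF, hK⟩ := hind N
    have h1 : (N : ℝ) * (‖g‖ / 2) ≤ ‖K‖ * ‖F‖ := by
      have h2 := norm_sub_norm_le ((N : ℂ) • g) (K F)
      rw [norm_sub_rev, norm_smul, Complex.norm_natCast] at h2
      have h3 := K.le_opNorm F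
      linarith
    have h2 : ((N : ℝ) * (‖g‖ / 2)) ^ p.toReal ≤ (‖K‖ * ‖F‖) ^ p.toReal := by gcongr
    rw [Real.mul_rpow (by positivity) (by positivity),
      Real.mul_rpow (by positivity) (by positivity)] at h2
    rw [hC, le_div_iff₀ (by positivity), Real.rpow_sub_one hN'.ne', div_mul_eq_mul_div,
      div_le_iff₀ hN']
    calc _ ≤ ‖K‖ ^ p.toReal * ‖F‖ ^ p.toReal := h2
      _ ≤ ‖K‖ ^ p.toReal * (2 * N) := by gcongr
      _ = _ := by ring
  have hlim := (tendsto_rpow_atTop (sub_pos.2 hq)).comp (tendsto_natCast_atTop_atTop (R := ℝ))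
  obtain ⟨N, hN1, hN2⟩ := ((hlim.eventually_gt_atTop C).and (eventually_gt_atTop 0)).exists
  exact absurd (hbound N hN2) (not_le.2 hN1)

/-- Compact operators map kernel functions that approach the boundary to null sequences. -/
theorem tendsto_map_kernel_zero {V : Type*} [NormedAddCommGroup V] [NormedSpace ℂ V]
    (hp1 : 1 < p) (hp : p ≠ ∞) {w : ℕ → Cn n} {ζ : Cn n}
    (hw1 : ∀ j, ‖w j‖ < 1) (hw : Tendsto w atTop (𝓝 ζ)) (hζ : ‖ζ‖ = 1)
    {K : HardySpace n p →L[ℂ] V} (hK : IsCompactOperator K) :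
    Tendsto (fun j => K (kernel hp (hw1 j))) atTop (𝓝 0) := by
  -- Compactness gives every subsequence a further one with convergent images, and the gliding hump
  -- argument forces that limit to vanish.
  refine tendsto_of_subseq_tendsto fun s hs => ?_
  have hcomp := IsCompactOperator.isCompact_closure_image_closedBall
    (f := (K : HardySpace n p →ₗ[ℂ] V)) hK 1
  obtain ⟨g, -, t, ht, hg⟩ := hcomp.tendsto_subseq
    (x := fun j => K (kernel hp (hw1 (s j)))) fun j => subset_closure
      ⟨_, mem_closedBall_zero_iff.2 (norm_kernel_le hp (hw1 (s j))), rfl⟩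
  have := eq_zero_of_tendsto_map_kernel hp1 hp (w := fun j => w (s (t j)))
    (fun j => hw1 _) (hw.comp (hs.comp ht.tendsto_atTop)) hζ K hg
  subst this
  exact ⟨t, hg⟩

end HardySpace

/-! ### Weighted composition operators -/

theorem infDist_sphere_eq {n : ℕ} [NeZero n] {x : Cn n} (hx : ‖x‖ < 1) :
    infDist x (sphere (0 : Cn n) 1) = 1 - ‖x‖ := by
  have hne : (sphere (0 : Cn n) 1).Nonempty := NormedSpace.sphere_nonempty.2 zero_le_one
  refine le_antisymm ?_ ((le_infDist hne).2 fun y hy => ?_)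
  · obtain ⟨e, he, hxe⟩ : ∃ e : Cn n, ‖e‖ = 1 ∧ x = ‖x‖ • e := by
      by_cases h0 : x = 0
      · obtain ⟨e, he⟩ := hne
        exact ⟨e, by simpa using he, by simp [h0]⟩
      · have h0' := norm_ne_zero_iff.2 h0
        exact ⟨‖x‖⁻¹ • x, by rw [norm_smul, norm_inv, norm_norm, inv_mul_cancel₀ h0'],
          by rw [smul_inv_smul₀ h0']⟩
    refine (infDist_le_dist_of_mem (mem_sphere_zero_iff_norm.2 he)).trans_eq ?_
    rw [dist_comm, dist_eq_norm]
    nth_rewrite 1 [hxe]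
    rw [← one_smul ℝ e, smul_smul, ← sub_smul, norm_smul, he, mul_one, mul_one, Real.norm_eq_abs,
      abs_of_pos (sub_pos.2 hx)]
  · rw [dist_comm, dist_eq_norm]
    have := norm_sub_norm_le y x
    rwa [mem_sphere_zero_iff_norm.1 hy] at this

theorem boundarySup_mono {n : ℕ} (p : ℝ≥0∞) (ψ : Cn n → ℂ) (φ : Cn n → Cn n) :
    Monotone (boundarySup p ψ φ) := fun _ _ h =>
  biSup_mono fun _ hz => ⟨hz.1, hz.2.trans_le h⟩

section WeightedComposition

variable {n : ℕ} [NeZero n] {p : ℝ≥0∞} [Fact (1 ≤ p)] {ψ : Cn n → ℂ} {φ : Cn n → Cn n}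
  {W : HardySpace n p →L[ℂ] HardySpace n ∞}

theorem toFun_apply_of_eq_weightedComp
    (hW : ∀ f : HardySpace n p, (W f).toFun = weightedComp ψ φ f.toFun) (f : HardySpace n p)
    {z : Cn n} (hz : z ∈ ball (0 : Cn n) 1) : (W f).toFun z = ψ z * f.toFun (φ z) := by
  rw [hW, weightedComp, indicator_of_mem hz]

/-- The kernel at `φ z` is extremal for evaluation at `φ z`, so it reads off the weight quotient at
`z`. -/
theorem norm_weight_mul_kernel (hp : p ≠ ∞)
    (hW : ∀ f : HardySpace n p, (W f).toFun = weightedComp ψ φ f.toFun)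
    {z : Cn n} (hz : z ∈ ball (0 : Cn n) 1) (hφz : ‖φ z‖ < 1) :
    ‖(W (HardySpace.kernel hp hφz)).toFun z‖ =
      ‖ψ z‖ / (1 - ‖φ z‖ ^ 2) ^ ((n : ℝ) / p.toReal) := by
  rw [toFun_apply_of_eq_weightedComp hW _ hz, norm_mul, HardySpace.toFun_kernel,
    norm_kernelFun_self hφz, Real.rpow_neg (one_sub_norm_sq_pos hφz).le]
  exact (div_eq_mul_inv _ _).symm

theorem weight_div_le_opNorm (hp : p ≠ ∞)
    (hW : ∀ f : HardySpace n p, (W f).toFun = weightedComp ψ φ f.toFun)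
    (hφB : MapsTo φ (ball 0 1) (ball 0 1)) {z : Cn n} (hz : z ∈ ball (0 : Cn n) 1) :
    ‖ψ z‖ / (1 - ‖φ z‖ ^ 2) ^ ((n : ℝ) / p.toReal) ≤ ‖W‖ := by
  have hφz : ‖φ z‖ < 1 := mem_ball_zero_iff.1 (hφB hz)
  rw [← norm_weight_mul_kernel hp hW hz hφz]
  exact (HardySpace.norm_apply_le_norm _ z).trans
    (W.unit_le_opNorm _ (HardySpace.norm_kernel_le hp hφz))

theorem norm_weight_le_opNorm (hp : p ≠ ∞)
    (hW : ∀ f : HardySpace n p, (W f).toFun = weightedComp ψ φ f.toFun)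
    (hφB : MapsTo φ (ball 0 1) (ball 0 1)) {z : Cn n} (hz : z ∈ ball (0 : Cn n) 1) :
    ‖ψ z‖ ≤ ‖W‖ := by
  refine le_trans ?_ (weight_div_le_opNorm hp hW hφB hz)
  have hφz : ‖φ z‖ < 1 := mem_ball_zero_iff.1 (hφB hz)
  have h0 := one_sub_norm_sq_pos hφz
  refine le_div_self (norm_nonneg _) (by positivity) (Real.rpow_le_one h0.le ?_ ?_)
  · nlinarith [norm_nonneg (φ z)]
  · exact div_nonneg n.cast_nonneg ENNReal.toReal_nonneg

theorem boundarySup_le_opNorm (hp : p ≠ ∞)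
    (hW : ∀ f : HardySpace n p, (W f).toFun = weightedComp ψ φ f.toFun)
    (hφB : MapsTo φ (ball 0 1) (ball 0 1)) (δ : ℝ) :
    boundarySup p ψ φ δ ≤ ENNReal.ofReal ‖W‖ :=
  iSup₂_le fun _ hz => ENNReal.ofReal_le_ofReal (weight_div_le_opNorm hp hW hφB hz.1)

/-- The value at `z` is `ψ z * f (r • φ z)`, which only involves `f` on the closed ball of radius
`r`. Since `|ψ| ≤ ‖W‖`, the operator is dominated by the compact restriction. -/
theorem isCompactOperator_comp_dilation (hp1 : 1 < p) (hp : p ≠ ∞)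
    (hW : ∀ f : HardySpace n p, (W f).toFun = weightedComp ψ φ f.toFun)
    (hφB : MapsTo φ (ball 0 1) (ball 0 1)) {r : ℝ} (hr : r ∈ Ioo (0 : ℝ) 1) :
    IsCompactOperator (W.comp (HardySpace.dilation hp hr)) := by
  refine isCompactOperator_of_norm_le (HardySpace.isCompactOperator_restrict (n := n) hp1 hp hr.2)
    (M := ‖W‖) fun f => ?_
  refine HardySpace.norm_top_le (by positivity) fun z hz => ?_
  have hφz : ‖φ z‖ < 1 := mem_ball_zero_iff.1 (hφB hz)
  have hmem : r • φ z ∈ closedBall (0 : Cn n) r := by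
    rw [mem_closedBall_zero_iff, norm_smul, Real.norm_eq_abs, abs_of_pos hr.1]
    exact mul_le_of_le_one_right hr.1.le hφz.le
  rw [ContinuousLinearMap.comp_apply, toFun_apply_of_eq_weightedComp hW _ hz, norm_mul,
    HardySpace.dilation_apply hp hr f (hφB hz)]
  refine mul_le_mul (norm_weight_le_opNorm hp hW hφB hz) ?_ (norm_nonneg _) (norm_nonneg _)
  exact (HardySpace.restrict hp1 hp hr.2 f).norm_coe_le_norm ⟨_, hmem⟩

/-- Approximation by compact operators up to twice the boundary supremum. -/
theorem exists_isCompactOperator_norm_sub_le (hp1 : 1 < p) (hp : p ≠ ∞)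
    (hW : ∀ f : HardySpace n p, (W f).toFun = weightedComp ψ φ f.toFun)
    (hφB : MapsTo φ (ball 0 1) (ball 0 1)) {δ : ℝ} (hδ : 0 < δ) {C : ℝ} (hC : 0 ≤ C)
    (hS : boundarySup p ψ φ δ ≤ ENNReal.ofReal C) {ε : ℝ} (hε : 0 < ε) :
    ∃ K : HardySpace n p →L[ℂ] HardySpace n ∞, IsCompactOperator K ∧ ‖W - K‖ ≤ 2 * C + ε := by
  obtain ⟨A, hA0, hA⟩ := HardySpace.exists_norm_sub_apply_le (n := n) hp1 hp
    (show 1 - δ < 1 by linarith)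
  -- The Lipschitz error on `‖φ z‖ ≤ 1 - δ` is at most `‖W‖ * A * (1 - r) * ‖f‖`, so `r` is taken
  -- close enough to one.
  obtain ⟨r, hr, hrε⟩ : ∃ r ∈ Ioo (0 : ℝ) 1, ‖W‖ * A * (1 - r) ≤ ε := by
    have h1 : Tendsto (fun r : ℝ => ‖W‖ * A * (1 - r)) (𝓝[<] 1) (𝓝 0) := by
      have : Continuous fun r : ℝ => ‖W‖ * A * (1 - r) := by fun_prop
      have h := this.tendsto 1
      simp only [sub_self, mul_zero] at h
      exact h.mono_left nhdsWithin_le_nhds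
    have h2 : ∀ᶠ r in 𝓝[<] (1 : ℝ), r ∈ Ioo (0 : ℝ) 1 := Ioo_mem_nhdsLT zero_lt_one
    exact (h2.and (h1.eventually_le_const hε)).exists
  refine ⟨_, isCompactOperator_comp_dilation hp1 hp hW hφB hr, ?_⟩
  refine ContinuousLinearMap.opNorm_le_bound _ (by positivity) fun f => ?_
  refine HardySpace.norm_top_le (by positivity) fun z hz => ?_
  have hφz : ‖φ z‖ < 1 := mem_ball_zero_iff.1 (hφB hz)
  have ha0 := one_sub_norm_sq_pos hφz
  rw [_root_.sub_apply, ContinuousLinearMap.comp_apply, ← map_sub,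
    toFun_apply_of_eq_weightedComp hW _ hz, norm_mul]
  -- Near the boundary the growth estimate is applied to `f - D_r f`, whose norm is only known to be
  -- at most `2‖f‖`: this produces `2 * C`. In the other case the Lipschitz bound produces `ε`.
  by_cases hd : 1 - ‖φ z‖ < δ
  · have h1 : ‖ψ z‖ / (1 - ‖φ z‖ ^ 2) ^ ((n : ℝ) / p.toReal) ≤ C := by
      refine (ENNReal.ofReal_le_ofReal_iff hC).1 (le_trans ?_ hS)
      exact le_iSup₂ (f := fun z (_ : z ∈ {z : Cn n | z ∈ ball (0 : Cn n) 1 ∧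
        infDist (φ z) (sphere (0 : Cn n) 1) < δ}) =>
        ENNReal.ofReal (‖ψ z‖ / (1 - ‖φ z‖ ^ 2) ^ ((n : ℝ) / p.toReal))) z
        ⟨hz, by rwa [infDist_sphere_eq hφz]⟩
    have h2 := (f - HardySpace.dilation hp hr f).norm_apply_le hp1 hp hφz
    have h3 : ‖f - HardySpace.dilation hp hr f‖ ≤ 2 * ‖f‖ := by
      have h4 := norm_sub_le f (HardySpace.dilation hp hr f)
      have h5 := HardySpace.norm_dilation_apply_le hp hr f
      linarith
    rw [Real.rpow_neg ha0.le] at h2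
    calc _ ≤ ‖ψ z‖ * (((1 - ‖φ z‖ ^ 2) ^ ((n : ℝ) / p.toReal))⁻¹ * (2 * ‖f‖)) := by
          refine mul_le_mul_of_nonneg_left (h2.trans ?_) (norm_nonneg _)
          gcongr
      _ = ‖ψ z‖ / (1 - ‖φ z‖ ^ 2) ^ ((n : ℝ) / p.toReal) * (2 * ‖f‖) := by ring
      _ ≤ C * (2 * ‖f‖) := by gcongr
      _ ≤ _ := by nlinarith [norm_nonneg f]
  · have hm : φ z ∈ closedBall (0 : Cn n) (1 - δ) := by
      rw [mem_closedBall_zero_iff]; linarith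
    have hm' : r • φ z ∈ closedBall (0 : Cn n) (1 - δ) := by
      rw [mem_closedBall_zero_iff] at hm ⊢
      rw [norm_smul, Real.norm_eq_abs, abs_of_pos hr.1]
      exact (mul_le_of_le_one_left (norm_nonneg _) hr.2.le).trans hm
    have h1 := hA f _ hm _ hm'
    have h2 : ‖φ z - r • φ z‖ ≤ 1 - r := by
      have : φ z - r • φ z = (1 - r) • φ z := by rw [sub_smul, one_smul]
      rw [this, norm_smul, Real.norm_eq_abs, abs_of_pos (sub_pos.2 hr.2)]
      exact mul_le_of_le_one_right (sub_pos.2 hr.2).le hφz.le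
    rw [HardySpace.toFun_sub, HardySpace.dilation_apply hp hr f (hφB hz)]
    calc _ ≤ ‖W‖ * (A * ‖f‖ * (1 - r)) := by
          refine mul_le_mul (norm_weight_le_opNorm hp hW hφB hz) (h1.trans ?_) (norm_nonneg _)
            (norm_nonneg _)
          gcongr
      _ = (‖W‖ * A * (1 - r)) * ‖f‖ := by ring
      _ ≤ ε * ‖f‖ := by gcongr
      _ ≤ _ := by nlinarith [norm_nonneg f]

/-- Lower bound for the distance to a compact operator. -/
theorem le_norm_sub_of_isCompactOperator (hp1 : 1 < p) (hp : p ≠ ∞)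
    (hW : ∀ f : HardySpace n p, (W f).toFun = weightedComp ψ φ f.toFun)
    (hφB : MapsTo φ (ball 0 1) (ball 0 1)) {c : ℝ}
    (hc : ∀ δ > 0, ∃ z ∈ ball (0 : Cn n) 1, 1 - ‖φ z‖ < δ ∧
      c ≤ ‖ψ z‖ / (1 - ‖φ z‖ ^ 2) ^ ((n : ℝ) / p.toReal))
    {K : HardySpace n p →L[ℂ] HardySpace n ∞} (hK : IsCompactOperator K) : c ≤ ‖W - K‖ := by
  choose z hz hzφ hzc using fun j : ℕ => hc (1 / (j + 1)) (by positivity)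
  have hφz : ∀ j, ‖φ (z j)‖ < 1 := fun j => mem_ball_zero_iff.1 (hφB (hz j))
  -- Pass to a convergent subsequence of `φ(z_j)`; the bounds `1 / (j + 1)` put its limit on the
  -- sphere, as the null property of kernels requires.
  obtain ⟨ζ, -, t, ht, hζ⟩ := (isCompact_closedBall (0 : Cn n) 1).tendsto_subseq
    (x := fun j => φ (z j)) fun j => ball_subset_closedBall (hφB (hz j))
  have hζ1 : ‖ζ‖ = 1 := by
    have h1 : Tendsto (fun j => 1 - ‖φ (z (t j))‖) atTop (𝓝 (1 - ‖ζ‖)) := hζ.norm.const_sub 1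
    have h2 : Tendsto (fun j => 1 - ‖φ (z (t j))‖) atTop (𝓝 0) := by
      refine squeeze_zero (fun j => (sub_pos.2 (hφz _)).le) (fun j => (hzφ (t j)).le) ?_
      exact tendsto_one_div_add_atTop_nhds_zero_nat.comp ht.tendsto_atTop
    have := tendsto_nhds_unique h1 h2
    linarith
  have hnull := HardySpace.tendsto_map_kernel_zero hp1 hp (w := fun j => φ (z (t j)))
    (fun j => hφz _) hζ hζ1 hK
  have hlim := hnull.norm.const_sub c
  rw [norm_zero, sub_zero] at hlim
  refine le_of_tendsto hlim (Eventually.of_forall fun j => ?_)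
  set k := HardySpace.kernel (p := p) hp (hφz (t j))
  have h1 : c ≤ ‖W k‖ := by
    refine (hzc (t j)).trans ?_
    rw [← norm_weight_mul_kernel hp hW (hz (t j)) (hφz (t j))]
    exact HardySpace.norm_apply_le_norm _ _
  have h2 : ‖W k - K k‖ ≤ ‖W - K‖ := (W - K).unit_le_opNorm k (HardySpace.norm_kernel_le hp _)
  have h3 := norm_sub_norm_le (W k) (K k)
  linarith

end WeightedComposition

/-! ### The essential norm and the main theorem -/

theorem bddBelow_range_norm_sub {E F : Type*} [NormedAddCommGroup E] [NormedSpace ℂ E]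
    [NormedAddCommGroup F] [NormedSpace ℂ F] (T : E →L[ℂ] F) :
    BddBelow (range fun K : {K : E →L[ℂ] F // IsCompactOperator K} => ‖T - K.1‖) :=
  ⟨0, by rintro _ ⟨K, rfl⟩; exact norm_nonneg _⟩

theorem essentialNorm_le {E F : Type*} [NormedAddCommGroup E] [NormedSpace ℂ E]
    [NormedAddCommGroup F] [NormedSpace ℂ F] (T : E →L[ℂ] F) {K : E →L[ℂ] F}
    (hK : IsCompactOperator K) : essentialNorm T ≤ ‖T - K‖ :=
  ciInf_le (bddBelow_range_norm_sub T) ⟨K, hK⟩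

theorem le_essentialNorm {E F : Type*} [NormedAddCommGroup E] [NormedSpace ℂ E]
    [NormedAddCommGroup F] [NormedSpace ℂ F] (T : E →L[ℂ] F) {c : ℝ}
    (h : ∀ K : E →L[ℂ] F, IsCompactOperator K → c ≤ ‖T - K‖) : c ≤ essentialNorm T := by
  have : Nonempty {K : E →L[ℂ] F // IsCompactOperator K} := ⟨⟨0, isCompactOperator_zero⟩⟩
  exact le_ciInf fun K => h K.1 K.2

end

theorem theorem5p2 {n : ℕ} [NeZero n] (p : ℝ≥0∞) [Fact (1 ≤ p)] (hp : 1 < p) (hp' : p ≠ ∞)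
    (ψ : Cn n → ℂ) (φ : Cn n → Cn n)
    (hψ : DifferentiableOn ℂ ψ (ball 0 1))
    (hφ : DifferentiableOn ℂ φ (ball 0 1))
    (hφB : MapsTo φ (ball 0 1) (ball 0 1))
    (W : HardySpace n p →L[ℂ] HardySpace n ∞)
    (hW : ∀ f : HardySpace n p, (W f).toFun = weightedComp ψ φ f.toFun) :
    ∃ L : ℝ≥0,
      Tendsto (boundarySup p ψ φ) (𝓝[>] 0) (𝓝 (L : ℝ≥0∞)) ∧
      (L : ℝ) ≤ essentialNorm W ∧ essentialNorm W ≤ 2 * (L : ℝ) ∧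
      (IsCompactOperator W ↔ L = 0) := by
  have hlim := (boundarySup_mono p ψ φ).tendsto_nhdsGT 0
  set S := sInf (boundarySup p ψ φ '' Ioi 0) with hS
  have hSle : ∀ δ > 0, S ≤ boundarySup p ψ φ δ := fun δ hδ => sInf_le ⟨δ, hδ, rfl⟩
  have hStop : S ≠ ∞ := ne_top_of_le_ne_top ENNReal.ofReal_ne_top
    ((hSle 1 one_pos).trans (boundarySup_le_opNorm hp' hW hφB 1))
  lift S to ℝ≥0 using hStop with L hL
  have hlow : ∀ K : HardySpace n p →L[ℂ] HardySpace n ∞, IsCompactOperator K →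
      (L : ℝ) ≤ ‖W - K‖ := by
    intro K hK
    refine le_of_forall_lt fun c hc => ?_
    obtain ⟨c', hcc', hc'⟩ := exists_between hc
    refine hcc'.trans_le ?_
    -- `ENNReal.ofReal` truncates negative numbers, so comparison with the extended supremum needs
    -- `c' ≥ 0`; negative values are trivial.
    by_cases hc0 : c' < 0
    · exact hc0.le.trans (norm_nonneg _)
    refine le_norm_sub_of_isCompactOperator hp hp' hW hφB (fun δ hδ => ?_) hK
    have h1 : ENNReal.ofReal c' < boundarySup p ψ φ δ := by
      refine lt_of_lt_of_le ?_ (hSle δ hδ)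
      rw [← ENNReal.ofReal_coe_nnreal]
      exact (ENNReal.ofReal_lt_ofReal_iff_of_nonneg (not_lt.1 hc0)).2 hc'
    obtain ⟨z, hz⟩ := lt_iSup_iff.1 h1
    obtain ⟨⟨hz1, hz2⟩, hz3⟩ := lt_iSup_iff.1 hz
    rw [infDist_sphere_eq (mem_ball_zero_iff.1 (hφB hz1))] at hz2
    exact ⟨z, hz1, hz2, (ENNReal.ofReal_lt_ofReal_iff_of_nonneg (not_lt.1 hc0)).1 hz3 |>.le⟩
  have hup : ∀ ε > 0, ∃ K : HardySpace n p →L[ℂ] HardySpace n ∞, IsCompactOperator K ∧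
      ‖W - K‖ ≤ 2 * L + ε := by
    intro ε hε
    -- The budget is `2 (L + ε/4) + ε/2 = 2L + ε`.
    have h1 : (L : ℝ≥0∞) < ENNReal.ofReal (L + ε / 4) := by
      rw [← ENNReal.ofReal_coe_nnreal]
      exact (ENNReal.ofReal_lt_ofReal_iff (by positivity)).2 (by linarith)
    obtain ⟨δ, hδ1, hδ⟩ := ((hlim.eventually_lt_const h1).and self_mem_nhdsWithin).exists
    obtain ⟨K, hK, hWK⟩ := exists_isCompactOperator_norm_sub_le hp hp' hW hφB hδ
      (by positivity) hδ1.le (half_pos hε)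
    exact ⟨K, hK, hWK.trans (by linarith)⟩
  refine ⟨L, hlim, le_essentialNorm W hlow, ?_, fun h => ?_, fun h => ?_⟩
  · refine le_of_forall_pos_le_add fun ε hε => ?_
    obtain ⟨K, hK, hWK⟩ := hup ε hε
    exact (essentialNorm_le W hK).trans hWK
  · have := hlow W h
    rw [sub_self, norm_zero] at this
    exact le_antisymm (by exact_mod_cast this) zero_le
  · have hcl : IsClosed {K : HardySpace n p →L[ℂ] HardySpace n ∞ | IsCompactOperator K} :=
      isClosed_setOfPred_isCompactOperator
    refine hcl.closure_subset (Metric.mem_closure_iff.2 fun ε hε => ?_)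
    obtain ⟨K, hK, hWK⟩ := hup (ε / 2) (half_pos hε)
    refine ⟨K, hK, ?_⟩
    rw [dist_eq_norm]
    rw [h, NNReal.coe_zero, mul_zero, zero_add] at hWK
    exact hWK.trans_lt (half_lt_self hε)
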